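/- Let $n\ge 0$ and $[n]=\{1,\dots,n\}$. A subset $A\subseteq[n]$ with $|A|=k$ codes the monotone lattice path from $(0,0)$ to $(n-k,k)$ whose $i$-th step is north if $i\in A$ and east otherwise. For $U,L\subseteq[n]$ with $|U|=|L|$ such that the path $U$ stays weakly above the path $L$, the lattice path matroid $M[U,L]$ is the matroid on $[n]$ whose bases are the sets $B\subseteq[n]$ with $|B|=|U|$ whose path lies weakly between $L$ and $U$. Let $\mathcal P_n$ be the set of all lattice path matroids on $[n]$, partially ordered by $M'\le_q M$ if and only if $M'$ is a quotient of $M$, i.e. there are a matroid $N$ and a subset $T$ of its ground set with $M=N\setminus T$ and $M'=N/T$. Let $\mu$ be the Möbius function of $\mathcal P_n$, and let $U_{0,n},U_{n,n}\in\mathcal P_n$ be the uniform matroids on $[n]$ of rank $0$ and $n$. For a permutation $w\in S_n$ and $j\in[n]$ put $L_j(w)=|\{k>j: w(k)<w(j)\}|$ and $L'_j(w)=L_j(w^{-1})$, and let $A(w)=\{i\in[n-1]: w(i)<w(i+1)\}$ be the ascent set of $w$. Let $GP(n)$ be the set of pairs $(\sigma,\tau)\in S_n\times S_n$ such that $L_j(\sigma)\ge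 L_j(\tau)$ and $L'_{\sigma(j)}(\sigma)\ge L'_{\tau(j)}(\tau)$ for all $j\in[n]$. **Theorem.** $$\mu(U_{0,n},U_{n,n})=(-1)^n\,\bigl|\{(\sigma,\tau)\in GP(n): A(\sigma)\cap A(\tau)=\emptyset\}\bigr|.$$ -/

import Mathlib

open scoped Matroid

namespace LatticePathMatroid

/-! ### Matroid quotients

Matroids live on finite ground sets `E ⊆ ℕ` (later `E = {1, …, n}`), so that there is always room
outside `E` for the extra elements of the matroid `N` in the definition of a quotient. -/

/-- `IsQuotient M' M`: the matroid `M'` is a quotient of `M`, that is, there are a (finite) matroid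
`N` and a subset `T` of its ground set with `M = N ＼ T` and `M' = N ／ T`. -/
def IsQuotient (M' M : Matroid ℕ) : Prop :=
  ∃ (N : Matroid ℕ) (T : Set ℕ), N.E.Finite ∧ T ⊆ N.E ∧ M = N ＼ T ∧ M' = N ／ T

theorem IsQuotient.ground_eq {M' M : Matroid ℕ} (h : IsQuotient M' M) : M'.E = M.E := by
  obtain ⟨N, T, -, -, rfl, rfl⟩ := h
  rfl

theorem IsQuotient.closure_subset {M' M : Matroid ℕ} (h : IsQuotient M' M) (X : Set ℕ) :
    M.closure X ⊆ M'.closure X := by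
  obtain ⟨N, T, -, -, rfl, rfl⟩ := h
  rw [Matroid.delete_closure_eq, Matroid.contract_closure_eq]
  exact Set.sdiff_subset_sdiff_left
    (N.closure_subset_closure (Set.sdiff_subset.trans Set.subset_union_left))

/-- Comparison of closures suffices for being a quotient; used below only for transitivity. -/
theorem isQuotient_of_closure_subset {M' M : Matroid ℕ} (hE : M'.E = M.E) (hfin : M.E.Finite)
    (hcl : ∀ X, M.closure X ⊆ M'.closure X) : IsQuotient M' M := by
  classical
  have hfin' : M'.E.Finite := hE ▸ hfin
  have : M.Finite := ⟨hfin⟩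
  have : M'.Finite := ⟨hfin'⟩
  -- natural number valued rank function of `M'`
  obtain ⟨r, hr⟩ : ∃ r : Set ℕ → ℕ, ∀ X, (r X : ℕ∞) = M'.eRk X :=
    ⟨fun X => (M'.eRk X).toNat, fun X => ENat.natCast_toNat (Matroid.eRk_ne_top_iff.2
      (Matroid.isRkFinite_set M' X))⟩
  have rmono : ∀ {X Y : Set ℕ}, X ⊆ Y → r X ≤ r Y := fun {X Y} h => by
    have := M'.eRk_mono h
    rw [← hr, ← hr] at this
    exact_mod_cast this
  have rsub : ∀ {X Y : Set ℕ}, X ⊆ Y → Y.Finite → r Y ≤ r X + (Y \ X).ncard :=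
    fun {X Y} h hY => by
      have h1 := M'.eRk_le_eRk_add_eRk_sdiff h
      have h2 := M'.eRk_le_encard (Y \ X)
      rw [← (hY.subset Set.sdiff_subset).cast_ncard_eq] at h2
      have h3 := h1.trans (add_le_add_right h2 _)
      rw [← hr, ← hr] at h3
      exact_mod_cast h3
  have rle : ∀ {X : Set ℕ}, X.Finite → r X ≤ X.ncard := fun {X} hX => by
    have h2 := M'.eRk_le_encard X
    rw [← hX.cast_ncard_eq, ← hr] at h2
    exact_mod_cast h2
  have rindep : ∀ {X : Set ℕ}, X.Finite → (M'.Indep X ↔ r X = X.ncard) := fun {X} hX => by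
    rw [Matroid.indep_iff_eRk_eq_encard_of_finite hX, ← hr, ← hX.cast_ncard_eq]
    exact_mod_cast Iff.rfl
  have hind : ∀ {X : Set ℕ}, M'.Indep X → M.Indep X := fun {X} hX => by
    rw [Matroid.indep_iff_forall_notMem_closure_sdiff (hE ▸ hX.subset_ground)]
    intro e he hc
    exact hX.notMem_closure_sdiff_of_mem he (hcl _ hc)
  obtain ⟨B, hB⟩ := M.exists_isBase
  have hBfin : B.Finite := hfin.subset hB.subset_ground
  have hBr : r M.E ≤ r B := by
    have h1 : M.E ⊆ M'.closure B := hB.closure_eq ▸ hcl B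
    have h2 := M'.eRk_mono h1
    rw [M'.eRk_closure_eq, ← hr, ← hr] at h2
    exact_mod_cast h2
  obtain ⟨k, hk⟩ : ∃ k, B.ncard = r B + k := Nat.exists_eq_add_of_le (rle hBfin)
  have hMk : ∀ {X : Set ℕ}, M.Indep X → X.ncard ≤ r X + k := fun {X} hX => by
    obtain ⟨C, hC, hXC⟩ := hX.exists_isBase_superset
    have hCfin : C.Finite := hfin.subset hC.subset_ground
    have h1 : C.ncard = B.ncard := hC.ncard_eq_ncard_of_isBase hB
    have h2 := Set.ncard_sdiff_add_ncard_of_subset hXC hCfin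
    have h3 := rsub hXC hCfin
    have h4 : r B ≤ r C := by
      have h1 : M.E ⊆ M'.closure C := hC.closure_eq ▸ hcl C
      have h2 := M'.eRk_mono (hB.subset_ground.trans h1)
      rw [M'.eRk_closure_eq, ← hr, ← hr] at h2
      exact_mod_cast h2
    omega
  obtain ⟨T, hTE, hTk⟩ : ∃ T : Finset ℕ, (T : Set ℕ) ⊆ M.Eᶜ ∧ T.card = k :=
    hfin.infinite_compl.exists_subset_card_eq k
  have hdisj : Disjoint M.E (T : Set ℕ) := (Set.subset_compl_iff_disjoint_left.1 hTE)
  have hUfin : (M.E ∪ T : Set ℕ).Finite := hfin.union T.finite_toSet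
  have hinterT : ∀ {a : ℕ} (_ : a ∈ T) (I : Set ℕ), insert a I ∩ M.E = I ∩ M.E :=
    fun {a} ha I => Set.insert_inter_of_notMem (fun h => hTE ha h)
  -- the matroid `N`
  let N : IndepMatroid ℕ := IndepMatroid.ofFinite hUfin
    (fun I => I ⊆ M.E ∪ T ∧ M.Indep (I ∩ M.E) ∧ I.ncard ≤ r (I ∩ M.E) + k)
    (by simp)
    (by
      rintro I J ⟨hJ, hJi, hJr⟩ hIJ
      have hJfin := hUfin.subset hJ
      refine ⟨hIJ.trans hJ, hJi.subset (Set.inter_subset_inter_left _ hIJ), ?_⟩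
      have h1 := rsub (Set.inter_subset_inter_left M.E hIJ) (hJfin.subset Set.inter_subset_left)
      have h2 := Set.ncard_sdiff_add_ncard_of_subset hIJ hJfin
      have h3 : ((J ∩ M.E) \ (I ∩ M.E)).ncard ≤ (J \ I).ncard :=
        Set.ncard_le_ncard (by rintro x ⟨⟨h, h'⟩, h''⟩; exact ⟨h, fun hi => h'' ⟨hi, h'⟩⟩)
          (hJfin.subset Set.sdiff_subset)
      omega)
    (by
      rintro I J ⟨hI, hIi, hIr⟩ ⟨hJ, hJi, hJr⟩ hlt
      have hIfin := hUfin.subset hI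
      have hJfin := hUfin.subset hJ
      rcases hIr.lt_or_eq with hIr | hIr
      · by_cases hT : J ∩ T ⊆ I
        · have hlt' : (I ∩ M.E).ncard < (J ∩ M.E).ncard := by
            have e1 : ∀ K : Set ℕ, K ⊆ M.E ∪ T → K.ncard = (K ∩ M.E).ncard + (K ∩ T).ncard := by
              intro K hK
              rw [← Set.ncard_union_eq (hdisj.mono Set.inter_subset_right Set.inter_subset_right)
                (hfin.subset Set.inter_subset_right)
                (T.finite_toSet.subset Set.inter_subset_right),
                ← Set.inter_union_distrib_left, Set.inter_eq_left.2 hK]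
            have h3 : (J ∩ T).ncard ≤ (I ∩ T).ncard :=
              Set.ncard_le_ncard (Set.subset_inter hT Set.inter_subset_right)
                (hIfin.subset Set.inter_subset_left)
            have := e1 I hI
            have := e1 J hJ
            omega
          have hlt'' : (I ∩ M.E).encard < (J ∩ M.E).encard := by
            rw [← (hIfin.subset Set.inter_subset_left).cast_ncard_eq,
              ← (hJfin.subset Set.inter_subset_left).cast_ncard_eq]
            exact_mod_cast hlt'
          obtain ⟨y, ⟨hyJ, hyI⟩, hy⟩ := hIi.exists_insert_of_encard_lt hJi hlt''
          have hyI' : y ∉ I := fun h => hyI ⟨h, hyJ.2⟩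
          refine ⟨y, hyJ.1, hyI', Set.insert_subset (hJ hyJ.1) hI, ?_, ?_⟩
          · rwa [Set.insert_inter_of_mem hyJ.2]
          · rw [Set.ncard_insert_of_notMem hyI' hIfin]
            have := rmono (Set.inter_subset_inter_left M.E (Set.subset_insert y I))
            omega
        · obtain ⟨a, ⟨haJ, haT⟩, haI⟩ := Set.not_subset.1 hT
          refine ⟨a, haJ, haI, Set.insert_subset (hJ haJ) hI, ?_, ?_⟩
          · rwa [hinterT haT]
          · rw [hinterT haT, Set.ncard_insert_of_notMem haI hIfin]
            omega
      · have hlt' : M'.eRk (I ∩ M.E) < M'.eRk (J ∩ M.E) := by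
          rw [← hr, ← hr]
          exact_mod_cast (by omega : r (I ∩ M.E) < r (J ∩ M.E))
        obtain ⟨y, ⟨hyJ, hyI⟩, hy⟩ := Matroid.exists_eRk_insert_eq_add_one_of_lt hlt'
        have hyI' : y ∉ I := fun h => hyI ⟨h, hyJ.2⟩
        have hy' : r (insert y (I ∩ M.E)) = r (I ∩ M.E) + 1 := by
          rw [← hr, ← hr] at hy
          exact_mod_cast hy
        have hycl : y ∉ M.closure (I ∩ M.E) := by
          intro h
          have h1 := M'.eRk_insert_closure_eq y (I ∩ M.E)
          rw [Set.insert_eq_of_mem (hcl _ h), M'.eRk_closure_eq, ← hr, ← hr] at h1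
          have h2 : r (I ∩ M.E) = r (insert y (I ∩ M.E)) := by exact_mod_cast h1
          omega
        refine ⟨y, hyJ.1, hyI', Set.insert_subset (hJ hyJ.1) hI, ?_, ?_⟩
        · rw [Set.insert_inter_of_mem hyJ.2]
          exact (hIi.insert_indep_iff_of_notMem hyI).2 ⟨hyJ.2, hycl⟩
        · rw [Set.insert_inter_of_mem hyJ.2, Set.ncard_insert_of_notMem hyI' hIfin]
          omega)
    (fun I hI => hI.1)
  have hNi : ∀ I, N.matroid.Indep I ↔
      I ⊆ M.E ∪ T ∧ M.Indep (I ∩ M.E) ∧ I.ncard ≤ r (I ∩ M.E) + k := fun I => Iff.rfl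
  have hNE : N.matroid.E = M.E ∪ T := rfl
  have hground : (M.E ∪ T) \ (T : Set ℕ) = M.E := by
    rw [Set.union_sdiff_right, hdisj.sdiff_eq_left]
  refine ⟨N.matroid, T, hUfin, Set.subset_union_right, ?_, ?_⟩
  · refine Matroid.ext_indep (by rw [Matroid.delete_ground, hNE, hground]) fun I hI => ?_
    rw [Matroid.delete_indep_iff, hNi, Set.inter_eq_left.2 hI]
    exact ⟨fun h => ⟨⟨hI.trans Set.subset_union_left, h, hMk h⟩, hdisj.mono_left hI⟩,
      fun h => h.1.2.1⟩
  · have hTi : N.matroid.Indep T := by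
      rw [hNi, hdisj.symm.inter_eq, Set.ncard_coe_finset]
      exact ⟨Set.subset_union_right, M.empty_indep, by omega⟩
    refine Matroid.ext_indep (by rw [Matroid.contract_ground, hNE, hground, hE]) fun I hI => ?_
    rw [hE] at hI
    have hIfin := hfin.subset hI
    have hd : Disjoint I (T : Set ℕ) := hdisj.mono_left hI
    rw [hTi.contract_indep_iff, hNi, Set.union_inter_distrib_right, hdisj.symm.inter_eq,
      Set.union_empty, Set.inter_eq_left.2 hI, Set.ncard_union_eq hd hIfin T.finite_toSet,
      Set.ncard_coe_finset, hTk, rindep hIfin]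
    constructor
    · intro h
      exact ⟨hd, Set.union_subset_union_left _ hI, hind ((rindep hIfin).2 h), by omega⟩
    · rintro ⟨-, -, -, h⟩
      have := rle hIfin
      omega

/-! ### Lattice path matroids and their quotient order -/

/-- The height of the lattice path coded by `A` after `i` steps; the path has steps `1, 2, …, n`,
and its `j`-th step is north if `j ∈ A` and east otherwise. -/
def height (A : Finset ℕ) (i : ℕ) : ℕ := (A.filter (· ≤ i)).card

/-- `LiesBetween n U L B`: the subsets `L`, `B`, `U` of `{1, …, n}` code monotone lattice paths from
`(0, 0)` to a common end point `(n - k, k)`, and the path `B` stays weakly above `L` and weakly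
below `U`. -/
def LiesBetween (n : ℕ) (U L B : Finset ℕ) : Prop :=
  B ⊆ Finset.Icc 1 n ∧ L.card = B.card ∧ B.card = U.card ∧
    ∀ i, height L i ≤ height B i ∧ height B i ≤ height U i

/-- `IsPathMatroid n U L M`: the sets `U, L ⊆ {1, …, n}` code noncrossing lattice paths with common
end points, the upper path `U` and the lower path `L`, and `M` is the lattice path matroid `M[U, L]`
on `{1, …, n}`: its bases are the (north steps of the) lattice paths between `U` and `L`. -/
def IsPathMatroid (n : ℕ) (U L : Finset ℕ) (M : Matroid ℕ) : Prop :=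
  U ⊆ Finset.Icc 1 n ∧ L ⊆ Finset.Icc 1 n ∧ L.card = U.card ∧ (∀ i, height L i ≤ height U i) ∧
    M.E = Set.Icc 1 n ∧ ∀ B : Finset ℕ, M.IsBase (B : Set ℕ) ↔ LiesBetween n U L B

/-- The set `𝒫 n` of lattice path matroids on the ground set `{1, …, n}`. -/
def LPM (n : ℕ) : Type := {M : Matroid ℕ // ∃ U L : Finset ℕ, IsPathMatroid n U L M}

theorem LPM.ground_eq {n : ℕ} (M : LPM n) : M.1.E = Set.Icc 1 n := by
  obtain ⟨U, L, -, -, -, -, h, -⟩ := M.2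
  exact h

theorem LPM.ground_finite {n : ℕ} (M : LPM n) : M.1.E.Finite :=
  M.ground_eq ▸ Set.finite_Icc 1 n

/-- The quotient order on `𝒫 n`: `M' ≤ M` if and only if `M'` is a quotient of `M`. -/
instance (n : ℕ) : PartialOrder (LPM n) where
  le M' M := IsQuotient M'.1 M.1
  le_refl M := isQuotient_of_closure_subset rfl M.ground_finite fun _ => subset_rfl
  le_trans M₁ M₂ M₃ h₁ h₂ :=
    isQuotient_of_closure_subset (h₁.ground_eq.trans h₂.ground_eq) M₃.ground_finite
      fun X => (h₂.closure_subset X).trans (h₁.closure_subset X)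
  le_antisymm _ _ h₁ h₂ := Subtype.ext <| Matroid.ext_closure fun X =>
    (h₂.closure_subset X).antisymm (h₁.closure_subset X)

instance (n : ℕ) : Finite (LPM n) := by
  classical
  have key : ∀ M : LPM n, ∃ p : {A : Finset ℕ // A ∈ (Finset.Icc 1 n).powerset} ×
      {A : Finset ℕ // A ∈ (Finset.Icc 1 n).powerset}, IsPathMatroid n p.1.1 p.2.1 M.1 := by
    rintro ⟨M, U, L, h⟩
    exact ⟨⟨⟨U, Finset.mem_powerset.2 h.1⟩, ⟨L, Finset.mem_powerset.2 h.2.1⟩⟩, h⟩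
  choose f hf using key
  refine Finite.of_injective f fun M₁ M₂ h => Subtype.ext ?_
  have h₁ := hf M₁
  rw [h] at h₁
  obtain ⟨-, -, -, -, e₁, b₁⟩ := h₁
  obtain ⟨-, -, -, -, e₂, b₂⟩ := hf M₂
  refine Matroid.ext_isBase (e₁.trans e₂.symm) fun B hB => ?_
  lift B to Finset ℕ using M₁.ground_finite.subset hB
  rw [b₁, b₂]

noncomputable instance (n : ℕ) : DecidableEq (LPM n) := Classical.decEq _

noncomputable instance (n : ℕ) : LocallyFiniteOrder (LPM n) := by
  classical
  have := Fintype.ofFinite (LPM n)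
  exact Fintype.toLocallyFiniteOrder

/-- The uniform matroid `U_{0,n}` of rank `0` on `{1, …, n}`, whose only basis is `∅`. -/
def uniformZero (n : ℕ) : LPM n :=
  ⟨Matroid.loopyOn (Set.Icc 1 n), ∅, ∅, by simp, by simp, rfl, fun _ => le_rfl, rfl, fun B => by
    simp only [Matroid.loopyOn_isBase_iff, Finset.coe_eq_empty, LiesBetween, Finset.card_empty]
    constructor
    · rintro rfl
      simp
    · rintro ⟨-, h, -⟩
      exact Finset.card_eq_zero.1 h.symm⟩

/-- The uniform matroid `U_{n,n}` of rank `n` on `{1, …, n}`, whose only basis is `{1, …, n}`. -/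
def uniformTop (n : ℕ) : LPM n :=
  ⟨Matroid.freeOn (Set.Icc 1 n), Finset.Icc 1 n, Finset.Icc 1 n, subset_rfl, subset_rfl, rfl,
    fun _ => le_rfl, rfl, fun B => by
    rw [Matroid.freeOn_isBase_iff, ← Finset.coe_Icc, Finset.coe_inj]
    constructor
    · rintro rfl
      exact ⟨subset_rfl, rfl, rfl, fun _ => ⟨le_rfl, le_rfl⟩⟩
    · rintro ⟨h, h', -⟩
      exact Finset.eq_of_subset_of_card_le h h'.le⟩

/-! ### Permutations

Permutations of `{1, …, n}` are modelled as permutations of `Fin n = {0, …, n - 1}`; all notions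
below only depend on the order of positions and values. -/

/-- The entry `L_j(w) = #{k > j : w(k) < w(j)}` of the Lehmer code of `w`. -/
def lehmer {n : ℕ} (w : Equiv.Perm (Fin n)) (j : Fin n) : ℕ :=
  (Finset.univ.filter fun k => j < k ∧ w k < w j).card

/-- `L'_j(w) = L_j(w⁻¹)`. -/
def lehmer' {n : ℕ} (w : Equiv.Perm (Fin n)) (j : Fin n) : ℕ := lehmer w⁻¹ j

/-- The set `GP(n)` of good pairs of permutations. -/
def GP (n : ℕ) : Set (Equiv.Perm (Fin n) × Equiv.Perm (Fin n)) :=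
  {p | ∀ j, lehmer p.1 j ≥ lehmer p.2 j ∧ lehmer' p.1 (p.1 j) ≥ lehmer' p.2 (p.2 j)}

/-- The ascent set of `w`: the positions `i`, not the last one, with `w(i) < w(i + 1)`. -/
def ascents {n : ℕ} (w : Equiv.Perm (Fin n)) : Set (Fin n) :=
  {i | ∃ h : i.1 + 1 < n, w i < w ⟨i.1 + 1, h⟩}

end LatticePathMatroid

namespace LatticePathMatroid

/-! ### Heights of lattice paths -/

/-! The quotient order is generated by elementary moves. Removing a north step `u` from the upper
path and a north step `l` from the lower one is allowed when `u` starts weakly north-west of `l`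
(`IsGood`). Such a move is a quotient (`IsPathMatroid.isQuotient_erase`): the bases of the larger
matroid, together with the bases of the smaller one enlarged by a new element 0, satisfy basis
exchange.

Conversely, if `M[U', L']` is a quotient of `M[U, L]`, then `U' ⊆ U` and `L' ⊆ L`, and pairing the
k-th element of `U \ U'` with the k-th element of `L \ L'` always gives good pairs
(`IsPathMatroid.isGood`). Removing them in increasing order is a word of good moves ascending in
both coordinates, and the only ascending word between the two matroids. So the moves behave like the
labels of an EL-labelling, although pairs of labels are only partially ordered.

The Möbius number from the bottom to `M` is therefore, up to the sign given by the rank, the number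
of ascent-free words from `M` to the bottom. To verify the recursion (`LPM.sum_ascentFree_eq_zero`),
an element `M'` below `M` with an ascent-free word is encoded by prefixing the unique ascending word
from `M` to `M'`. This gives a full word cut into an ascending and an ascent-free part, and for each
nonempty word the signs of its admissible cuts cancel.

From the top element, words are pairs of permutations. The height at which a removed step starts is
a Lehmer code entry, and the identity `val_add_lehmer'` turns the western half of goodness into the
inequality for `L'`; hence good words are `GP n`, and ascents of words are common ascents. -/

theorem height_succ (A : Finset ℕ) (i : ℕ) :
    height A (i + 1) = height A i + if i + 1 ∈ A then 1 else 0 := by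
  unfold height
  have h : A.filter (· ≤ i + 1) = A.filter (· ≤ i) ∪ A.filter (· = i + 1) := by
    ext x
    simp only [Finset.mem_filter, Finset.mem_union]
    grind
  rw [h, Finset.card_union_of_disjoint, Finset.filter_eq']
  · split_ifs <;> simp
  · rw [Finset.disjoint_left]
    intro x hx hx'
    simp only [Finset.mem_filter] at hx hx'
    omega

theorem height_pred (A : Finset ℕ) {i : ℕ} (hi : 1 ≤ i) :
    height A i = height A (i - 1) + if i ∈ A then 1 else 0 := by
  obtain ⟨j, rfl⟩ := Nat.exists_eq_add_of_le' hi
  simpa using height_succ A j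

theorem height_mono (A : Finset ℕ) : Monotone (height A) :=
  monotone_nat_of_le_succ fun i => by rw [height_succ]; omega

theorem height_zero {n : ℕ} {A : Finset ℕ} (hA : A ⊆ Finset.Icc 1 n) : height A 0 = 0 := by
  simp only [height, Finset.card_eq_zero, Finset.filter_eq_empty_iff]
  intro x hx
  have := Finset.mem_Icc.1 (hA hx)
  omega

theorem height_of_le {n i : ℕ} {A : Finset ℕ} (hA : A ⊆ Finset.Icc 1 n) (hi : n ≤ i) :
    height A i = A.card := by
  rw [height, Finset.filter_true_of_mem]
  intro x hx
  have := Finset.mem_Icc.1 (hA hx)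
  omega

theorem height_subset {A B : Finset ℕ} (h : A ⊆ B) (i : ℕ) : height A i ≤ height B i :=
  Finset.card_le_card (Finset.filter_subset_filter _ h)

theorem eq_of_height_eq {A B : Finset ℕ} (h : ∀ i, height A i = height B i) : A = B := by
  ext x
  rcases x with _ | x
  · have := h 0
    have key : ∀ A : Finset ℕ, height A 0 = if 0 ∈ A then 1 else 0 := fun A => by
      simp only [height, Nat.le_zero, Finset.filter_eq']
      split_ifs <;> simp
    rw [key, key] at this
    grind
  · have h1 := h x
    have h2 := h (x + 1)
    rw [height_succ, height_succ] at h2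
    grind

/-- Every function with increments `0` and `1` is the height function of a lattice path. -/
theorem exists_height_eq (n : ℕ) {g : ℕ → ℕ} (h0 : g 0 = 0)
    (hg : ∀ i, g i ≤ g (i + 1) ∧ g (i + 1) ≤ g i + 1) :
    ∃ A ⊆ Finset.Icc 1 n, ∀ i ≤ n, height A i = g i := by
  refine ⟨(Finset.Icc 1 n).filter fun i => g (i - 1) < g i, Finset.filter_subset _ _, ?_⟩
  intro i
  induction i with
  | zero => intro _; rw [height_zero (Finset.filter_subset _ _), h0]
  | succ i ih =>
    intro hi
    rw [height_succ, ih (by omega)]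
    have := hg i
    simp only [Finset.mem_filter, Finset.mem_Icc]
    simp only [Nat.add_sub_cancel]
    split_ifs <;> omega

theorem height_erase {A : Finset ℕ} {x : ℕ} (hx : x ∈ A) (i : ℕ) :
    height (A.erase x) i + (if x ≤ i then 1 else 0) = height A i := by
  unfold height
  rw [Finset.filter_erase]
  split_ifs with h
  · rw [Finset.card_erase_add_one (Finset.mem_filter.2 ⟨hx, h⟩)]
  · rw [Finset.erase_eq_of_notMem (s := A.filter (· ≤ i)) (fun h' => h (Finset.mem_filter.1 h').2),
      add_zero]

theorem height_insert {A : Finset ℕ} {x : ℕ} (hx : x ∉ A) (i : ℕ) :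
    height (insert x A) i = height A i + if x ≤ i then 1 else 0 := by
  rw [← height_erase (Finset.mem_insert_self x A) i, Finset.erase_insert hx]

/-! ### Drops of an integer sequence -/

/-- Take `y` to be the first position after `x` with value below `d x`; minimality bounds the
earlier values, in particular `d (y - 1)`. The left version instead takes the successor of the last
position with value above `d b`. -/
theorem exists_drop_right (d : ℕ → ℤ) {x m : ℕ} (hxm : x < m) (hd : d m < d x) :
    ∃ y, x < y ∧ y ≤ m ∧ d y < d (y - 1) ∧ ∀ i, x ≤ i → i < y → d x ≤ d i := by
  classical
  have hex : ∃ y, x < y ∧ d y < d x := ⟨m, hxm, hd⟩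
  have hmin : ∀ i, x ≤ i → i < Nat.find hex → d x ≤ d i := fun i hi hi' => by
    rcases hi.eq_or_lt with rfl | hlt
    · rfl
    · by_contra! h
      exact Nat.find_min hex hi' ⟨hlt, h⟩
  obtain ⟨h1, h2⟩ := Nat.find_spec hex
  exact ⟨Nat.find hex, h1, Nat.find_min' hex ⟨hxm, hd⟩,
    h2.trans_le (hmin _ (by omega) (by omega)), hmin⟩

theorem exists_drop_left (d : ℕ → ℤ) {a b : ℕ} (hab : a ≤ b) (hd : d b < d a) :
    ∃ y, a < y ∧ y ≤ b ∧ d y < d (y - 1) ∧ ∀ i, y ≤ i → i ≤ b → d i ≤ d b := by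
  classical
  set j := Nat.findGreatest (fun j => d b < d j) b with hj
  have h1 : d b < d j := Nat.findGreatest_spec (P := fun j => d b < d j) hab hd
  have h2 : a ≤ j := Nat.le_findGreatest hab hd
  have h3 : j ≤ b := Nat.findGreatest_le b
  have h4 : j ≠ b := fun h => by rw [h] at h1; exact lt_irrefl _ h1
  have h5 : ∀ i, j + 1 ≤ i → i ≤ b → d i ≤ d b := fun i hi hi' =>
    not_lt.1 (Nat.findGreatest_is_greatest (P := fun j => d b < d j) (by omega) hi')
  exact ⟨j + 1, by omega, by omega, by simpa using (h5 _ le_rfl (by omega)).trans_lt h1, h5⟩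

/-- If the difference of heights drops at `y`, then `y` is a north step of the second path only. -/
theorem mem_sdiff_of_drop {A B : Finset ℕ} {y : ℕ} (hy : 1 ≤ y)
    (h : (height A y : ℤ) - height B y < height A (y - 1) - height B (y - 1)) : y ∈ B \ A := by
  have hA := height_pred A hy
  have hB := height_pred B hy
  rw [Finset.mem_sdiff]
  split_ifs at hA hB <;> first | omega | tauto

/-! ### Symmetric exchange between lattice paths -/

/-- Moving a north step from `x` to a later `y` lowers the path by one on `[x, y)`; moving it to an
earlier `y` raises it by one on `[y, x)`. Slack is needed only on that interval. -/
theorem LiesBetween.swap {n : ℕ} {U L B : Finset ℕ} (hB : LiesBetween n U L B) {x y : ℕ}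
    (hx : x ∈ B) (hy : y ∉ B) (hyn : y ∈ Finset.Icc 1 n)
    (hlow : ∀ i, x ≤ i → i < y → height L i + 1 ≤ height B i)
    (hupp : ∀ i, y ≤ i → i < x → height B i + 1 ≤ height U i) :
    LiesBetween n U L (insert y (B.erase x)) := by
  obtain ⟨h1, h2, h3, h4⟩ := hB
  have hy' : y ∉ B.erase x := fun h => hy (Finset.mem_of_mem_erase h)
  have hc : (insert y (B.erase x)).card = B.card := by
    rw [Finset.card_insert_of_notMem hy', Finset.card_erase_add_one hx]
  refine ⟨Finset.insert_subset hyn ((Finset.erase_subset _ _).trans h1), by omega, by omega,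
    fun i => ?_⟩
  rw [height_insert hy']
  have h5 := height_erase hx i
  have := h4 i
  have := hlow i
  have := hupp i
  split_ifs at h5 ⊢ <;> omega

theorem LiesBetween.exists_swap_right {n : ℕ} {U L A B : Finset ℕ} (hA : LiesBetween n U L A)
    (hB : B ⊆ Finset.Icc 1 n) {x m : ℕ} (hx : x ∈ A) (hxm : x < m)
    (hd : (height A m : ℤ) - height B m < height A x - height B x)
    (hlow : ∀ i, x ≤ i → i < m → (height A x : ℤ) - height B x ≤ height A i - height B i →
      height L i + 1 ≤ height A i) :
    ∃ y ∈ B \ A, LiesBetween n U L (insert y (A.erase x)) := by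
  obtain ⟨y, h1, h2, h3, h4⟩ :=
    exists_drop_right (fun i => (height A i : ℤ) - height B i) hxm hd
  have hy := mem_sdiff_of_drop (by omega) h3
  have hy' := Finset.mem_sdiff.1 hy
  exact ⟨y, hy, hA.swap hx hy'.2 (hB hy'.1)
    (fun i hi hi' => hlow i hi (by omega) (h4 i hi hi')) (fun i hi hi' => by omega)⟩

theorem LiesBetween.exists_swap_left {n : ℕ} {U L A B : Finset ℕ} (hA : LiesBetween n U L A)
    (hB : B ⊆ Finset.Icc 1 n) {x a : ℕ} (hx : x ∈ A) (hax : a < x)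
    (hd : (height A (x - 1) : ℤ) - height B (x - 1) < height A a - height B a)
    (hupp : ∀ i, a < i → i < x →
      (height A i : ℤ) - height B i ≤ height A (x - 1) - height B (x - 1) →
      height A i + 1 ≤ height U i) :
    ∃ y ∈ B \ A, LiesBetween n U L (insert y (A.erase x)) := by
  obtain ⟨y, h1, h2, h3, h4⟩ :=
    exists_drop_left (fun i => (height A i : ℤ) - height B i) (by omega : a ≤ x - 1) hd
  have hy := mem_sdiff_of_drop (by omega) h3
  have hy' := Finset.mem_sdiff.1 hy
  exact ⟨y, hy, hA.swap hx hy'.2 (hB hy'.1) (fun i hi hi' => by omega)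
    (fun i hi hi' => hupp i (by omega) hi' (h4 i hi (by omega)))⟩

theorem height_sub_succ {A B : Finset ℕ} {x : ℕ} (hx : 1 ≤ x) (hA : x ∈ A) (hB : x ∉ B) :
    (height A x : ℤ) - height B x = height A (x - 1) - height B (x - 1) + 1 := by
  have h1 := height_pred A hx
  have h2 := height_pred B hx
  rw [if_pos hA] at h1
  rw [if_neg hB] at h2
  omega

/-- The sign of `d = height A - height B` at `x` decides the direction. If `d x > 0`, then `A` stays
strictly above `B`, hence above `L`, until `d` first falls below `d x`. Otherwise `d` is negative
just before `x`, and the mirror image works on the left with `U`. -/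
theorem LiesBetween.exchange {n : ℕ} {U L A B : Finset ℕ} (hA : LiesBetween n U L A)
    (hB : LiesBetween n U L B) {x : ℕ} (hx : x ∈ A) (hx' : x ∉ B) :
    ∃ y ∈ B \ A, LiesBetween n U L (insert y (A.erase x)) := by
  have hxn := Finset.mem_Icc.1 (hA.1 hx)
  have hs := height_sub_succ hxn.1 hx hx'
  rcases le_or_gt ((height A x : ℤ) - height B x) 0 with h | h
  · refine hA.exists_swap_left hB.1 hx (a := 0) (by omega) ?_ fun i hi hi' hd => ?_
    · rw [height_zero hA.1, height_zero hB.1]; omega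
    · have := (hB.2.2.2 i).2; omega
  -- The endpoint `n + 1` covers `x = n`; both heights are already constant from `n` on, so `d`
  -- vanishes there.
  · refine hA.exists_swap_right hB.1 hx (m := n + 1) (by omega) ?_ fun i hi hi' hd => ?_
    · rw [height_of_le hA.1 (by omega), height_of_le hB.1 (by omega), hA.2.2.1, hB.2.2.1]; omega
    · have := (hB.2.2.2 i).1; omega

/-! ### Existence of lattice path matroids -/

/-- A matroid on a finite set `E ⊆ ℕ` from its family of bases. -/
theorem exists_matroid_of_finset_bases (E : Finset ℕ) (P : Finset ℕ → Prop) (hne : ∃ B, P B)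
    (hsub : ∀ B, P B → B ⊆ E)
    (hex : ∀ A B, P A → P B → ∀ x ∈ A, x ∉ B → ∃ y ∈ B \ A, P (insert y (A.erase x))) :
    ∃ M : Matroid ℕ, M.E = E ∧ ∀ B : Finset ℕ, M.IsBase (B : Set ℕ) ↔ P B := by
  refine ⟨Matroid.ofExistsFiniteIsBase (E := (E : Set ℕ))
    (IsBase := fun S => ∃ B : Finset ℕ, (B : Set ℕ) = S ∧ P B) ?_ ?_ ?_, rfl, fun B => ?_⟩
  · obtain ⟨B, hB⟩ := hne
    exact ⟨B, ⟨B, rfl, hB⟩, B.finite_toSet⟩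
  · rintro _ _ ⟨A, rfl, hA⟩ ⟨B, rfl, hB⟩ x hx
    obtain ⟨y, hy, h⟩ := hex A B hA hB x (by simpa using hx.1) (by simpa using hx.2)
    exact ⟨y, by simpa using hy, _, by simp, h⟩
  · rintro _ ⟨B, rfl, hB⟩
    exact_mod_cast hsub B hB
  · exact ⟨fun ⟨B', h, h'⟩ => by rwa [← Finset.coe_injective h], fun h => ⟨B, rfl, h⟩⟩

/-- `U` and `L` code noncrossing lattice paths with common end points, `U` above `L`. -/
def Noncrossing (n : ℕ) (U L : Finset ℕ) : Prop :=
  U ⊆ Finset.Icc 1 n ∧ L ⊆ Finset.Icc 1 n ∧ L.card = U.card ∧ ∀ i, height L i ≤ height U i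

theorem Noncrossing.upper {n : ℕ} {U L : Finset ℕ} (h : Noncrossing n U L) :
    LiesBetween n U L U :=
  ⟨h.1, h.2.2.1, rfl, fun i => ⟨h.2.2.2 i, le_rfl⟩⟩

theorem Noncrossing.lower {n : ℕ} {U L : Finset ℕ} (h : Noncrossing n U L) :
    LiesBetween n U L L :=
  ⟨h.2.1, rfl, h.2.2.1, fun i => ⟨le_rfl, h.2.2.2 i⟩⟩

theorem IsPathMatroid.noncrossing {n : ℕ} {U L : Finset ℕ} {M : Matroid ℕ}
    (h : IsPathMatroid n U L M) : Noncrossing n U L :=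
  ⟨h.1, h.2.1, h.2.2.1, h.2.2.2.1⟩

theorem IsPathMatroid.ground {n : ℕ} {U L : Finset ℕ} {M : Matroid ℕ}
    (h : IsPathMatroid n U L M) : M.E = Set.Icc 1 n :=
  h.2.2.2.2.1

theorem IsPathMatroid.isBase_iff {n : ℕ} {U L : Finset ℕ} {M : Matroid ℕ}
    (h : IsPathMatroid n U L M) (B : Finset ℕ) :
    M.IsBase (B : Set ℕ) ↔ LiesBetween n U L B :=
  h.2.2.2.2.2 B

theorem Noncrossing.exists_matroid {n : ℕ} {U L : Finset ℕ} (h : Noncrossing n U L) :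
    ∃ M, IsPathMatroid n U L M := by
  obtain ⟨M, hE, hM⟩ := exists_matroid_of_finset_bases (Finset.Icc 1 n) (LiesBetween n U L)
    ⟨U, h.upper⟩ (fun B hB => hB.1) fun A B hA hB x hx hx' => hA.exchange hB hx hx'
  exact ⟨M, h.1, h.2.1, h.2.2.1, h.2.2.2, by simpa using hE, hM⟩

theorem IsPathMatroid.eq {n : ℕ} {U L : Finset ℕ} {M M' : Matroid ℕ}
    (h : IsPathMatroid n U L M) (h' : IsPathMatroid n U L M') : M = M' := by
  refine Matroid.ext_isBase (h.ground.trans h'.ground.symm) fun B hB => ?_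
  lift B to Finset ℕ using (Set.finite_Icc 1 n).subset (h.ground ▸ hB)
  rw [h.isBase_iff, h'.isBase_iff]

/-- The bounding paths are recovered as the highest and the lowest basis. -/
theorem IsPathMatroid.paths_eq {n : ℕ} {U L U' L' : Finset ℕ} {M : Matroid ℕ}
    (h : IsPathMatroid n U L M) (h' : IsPathMatroid n U' L' M) : U = U' ∧ L = L' := by
  have e : ∀ B, LiesBetween n U L B ↔ LiesBetween n U' L' B := fun B => by
    rw [← h.isBase_iff, h'.isBase_iff]
  have h1 := (e U).1 h.noncrossing.upper
  have h2 := (e U').2 h'.noncrossing.upper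
  have h3 := (e L).1 h.noncrossing.lower
  have h4 := (e L').2 h'.noncrossing.lower
  exact ⟨eq_of_height_eq fun i => (h1.2.2.2 i).2.antisymm (h2.2.2.2 i).2,
    eq_of_height_eq fun i => (h4.2.2.2 i).1.antisymm (h3.2.2.2 i).1⟩

/-! ### Elementary quotients -/

/-- The north step `u` of the path `U` starts weakly north-west of the north step `l` of the
path `L`. -/
structure IsGood (U L : Finset ℕ) (u l : ℕ) : Prop where
  mem_upper : u ∈ U
  mem_lower : l ∈ L
  north : height L (l - 1) ≤ height U (u - 1)
  west : u + height L (l - 1) ≤ l + height U (u - 1)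

section Elementary

variable {n : ℕ} {U L : Finset ℕ} {u l : ℕ}

/-- The quantity `i - height A i` is the east coordinate of the path after `i` steps. -/
theorem height_sub_mono (A : Finset ℕ) {i j : ℕ} (h : i ≤ j) :
    (i : ℤ) - height A i ≤ j - height A j := by
  induction j, h using Nat.le_induction with
  | base => rfl
  | succ j h ih =>
    have := height_succ A j
    push_cast
    split_ifs at this <;> omega

/-- A crossing could arise only for `u ≤ i < l`, where the upper path alone is lowered; there the
northern half of goodness leaves a gap of at least one. -/
theorem Noncrossing.erase (h : Noncrossing n U L) (hg : IsGood U L u l) :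
    Noncrossing n (U.erase u) (L.erase l) := by
  obtain ⟨h1, h2, h3, h4⟩ := h
  have hu := Finset.mem_Icc.1 (h1 hg.mem_upper)
  have hl := Finset.mem_Icc.1 (h2 hg.mem_lower)
  refine ⟨(Finset.erase_subset _ _).trans h1, (Finset.erase_subset _ _).trans h2, ?_, fun i => ?_⟩
  · rw [Finset.card_erase_of_mem hg.mem_upper, Finset.card_erase_of_mem hg.mem_lower, h3]
  · have hU := height_erase hg.mem_upper i
    have hL := height_erase hg.mem_lower i
    have hi := h4 i
    have hn := hg.north
    have e1 := height_pred U hu.1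
    rw [if_pos hg.mem_upper] at e1
    by_contra! hlt
    split_ifs at hU hL with c1 c2 c2
    · omega
    · have := height_mono U c1
      have := height_mono L (by omega : i ≤ l - 1)
      omega
    · omega
    · omega

/-- Heights of a path between `L` with the step `l` removed and `U` with the step `u` removed. -/
theorem LiesBetween.erase_bounds {A : Finset ℕ} (hA : LiesBetween n (U.erase u) (L.erase l) A)
    (hu : u ∈ U) (hl : l ∈ L) :
    A.card + 1 = U.card ∧ ∀ i, height A i ≤ height U i ∧ height L i ≤ height A i + 1 ∧
      (u ≤ i → height A i + 1 ≤ height U i) ∧ (i < l → height L i ≤ height A i) := by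
  obtain ⟨h1, h2, h3, h4⟩ := hA
  have := Finset.card_erase_add_one hu
  refine ⟨by omega, fun i => ?_⟩
  have hU := height_erase hu i
  have hL := height_erase hl i
  have := h4 i
  split_ifs at hU hL <;> omega

theorem exchange_delete_add {A B : Finset ℕ} {x : ℕ} (hU : U ⊆ Finset.Icc 1 n) (hu : u ∈ U)
    (hl : l ∈ L) (hA : LiesBetween n U L A) (hB : LiesBetween n (U.erase u) (L.erase l) B)
    (hx : x ∈ A) (hx' : x ∉ B) :
    LiesBetween n (U.erase u) (L.erase l) (A.erase x) ∨
      ∃ y ∈ B \ A, LiesBetween n U L (insert y (A.erase x)) := by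
  have hxn := Finset.mem_Icc.1 (hA.1 hx)
  have hs := height_sub_succ hxn.1 hx hx'
  obtain ⟨hc, hb⟩ := hB.erase_bounds hu hl
  have hAc := hA.2.2.1
  have hun := Finset.mem_Icc.1 (hU hu)
  rw [or_iff_not_imp_left]
  intro hnot
  -- Dropping `x` lowers `A` from `x` on, while the lower bound falls only from `l` on and the upper
  -- bound falls already from `u` on. So `A.erase x` can fail only by touching `L` in `[x, l)` or
  -- `U` in `[u, x)`. At such a point `B` lies on the favourable side of `A`, which forces a drop of
  -- the height difference in a range where `B` still obeys the original bound.
  have hviol : (∃ i, x ≤ i ∧ i < l ∧ height A i = height L i) ∨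
      ∃ i, i < x ∧ u ≤ i ∧ height A i = height U i := by
    by_contra! hcon
    refine hnot ⟨(Finset.erase_subset _ _).trans hA.1, ?_, ?_, fun i => ?_⟩
    · rw [Finset.card_erase_of_mem hx, Finset.card_erase_of_mem hl, hA.2.1]
    · rw [Finset.card_erase_of_mem hx, Finset.card_erase_of_mem hu, hA.2.2.1]
    · have e1 := height_erase hx i
      have e2 := height_erase hu i
      have e3 := height_erase hl i
      have c1 := hcon.1 i
      have c2 := hcon.2 i
      have := hA.2.2.2 i
      split_ifs at e1 e2 e3 <;> omega
  rcases hviol with ⟨i, hxi, hil, hi⟩ | ⟨i, hix, hui, hi⟩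
  · have hBi := (hb i).2.2.2 hil
    rcases le_or_gt ((height A x : ℤ) - height B x) 0 with h | h
    · refine hA.exists_swap_left hB.1 hx (a := 0) (by omega) ?_ fun j hj hj' hd => ?_
      · rw [height_zero hA.1, height_zero hB.1]; omega
      · have := (hb j).1; omega
    · have hne : x ≠ i := by rintro rfl; omega
      refine hA.exists_swap_right hB.1 hx (m := i) (by omega) (by omega) fun j hj hj' hd => ?_
      have := (hb j).2.2.2 (by omega); omega
  · have hBi := (hb i).2.2.1 hui
    rcases le_or_gt ((height A (x - 1) : ℤ) - height B (x - 1)) 0 with h | h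
    · refine hA.exists_swap_left hB.1 hx (a := i) hix (by omega) fun j hj hj' hd => ?_
      have := (hb j).2.2.1 (by omega); omega
    · refine hA.exists_swap_right hB.1 hx (m := n + 1) (by omega) ?_ fun j hj hj' hd => ?_
      · rw [height_of_le hA.1 (by omega), height_of_le hB.1 (by omega)]; omega
      · have := (hb j).2.1; omega

/-- Inserting `y` raises `A` from `y` on. It must come after the last contact `a` with `U` before
`u`, and no later than the first place `b` at or after `l` where `A` is below `L`. The western half
of goodness gives `a < b`, and between them `B` overtakes `A`. -/
theorem exchange_add_delete (hg : IsGood U L u l) (hU : U ⊆ Finset.Icc 1 n)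
    (hL : L ⊆ Finset.Icc 1 n) {A B : Finset ℕ} (hA : LiesBetween n (U.erase u) (L.erase l) A)
    (hB : LiesBetween n U L B) : ∃ y ∈ B \ A, LiesBetween n U L (insert y A) := by
  obtain ⟨hc, hb⟩ := hA.erase_bounds hg.mem_upper hg.mem_lower
  have hu := Finset.mem_Icc.1 (hU hg.mem_upper)
  have hl := Finset.mem_Icc.1 (hL hg.mem_lower)
  have hBc := hB.2.2.1
  have hLc := hB.2.1
  have hw := hg.west
  obtain ⟨a, hau, ha, ha0, ha'⟩ : ∃ a < u, height B a ≤ height A a ∧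
      (a = 0 ∨ height A a = height U a) ∧
      ∀ i, a < i → i < u → height A i + 1 ≤ height U i := by
    classical
    by_cases hex : ∃ a ≤ u - 1, height A a = height U a
    · obtain ⟨a, hau, ha⟩ := hex
      refine ⟨Nat.findGreatest (fun a => height A a = height U a) (u - 1), ?_, ?_, Or.inr ?_, ?_⟩
      · have := Nat.findGreatest_le (P := fun a => height A a = height U a) (u - 1)
        omega
      · have := Nat.findGreatest_spec (P := fun a => height A a = height U a) hau ha
        rw [this]
        exact (hB.2.2.2 _).2
      · exact Nat.findGreatest_spec (P := fun a => height A a = height U a) hau ha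
      · intro i hi hi'
        have := Nat.findGreatest_is_greatest (P := fun a => height A a = height U a) hi (by omega)
        have := (hb i).1
        omega
    · push Not at hex
      refine ⟨0, by omega, ?_, Or.inl rfl, fun i hi hi' => ?_⟩
      · rw [height_zero hA.1, height_zero hB.1]
      · have := (hb i).1
        have := hex i (by omega)
        omega
  have eL := height_pred L hl.1
  rw [if_pos hg.mem_lower] at eL
  obtain ⟨b, hab, hAB, hb'⟩ : ∃ b, a < b ∧ height A b < height B b ∧
      ∀ i, l ≤ i → i < b → height L i ≤ height A i := by
    classical
    by_cases hex : ∃ b, l ≤ b ∧ height A b < height L b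
    · obtain ⟨h1, h2⟩ := Nat.find_spec hex
      refine ⟨Nat.find hex, ?_, h2.trans_le (hB.2.2.2 _).1, fun i hi hi' => ?_⟩
      -- If `b ≤ a`, compare east coordinates: at `b`, `A` is strictly east of `L`, hence of the
      -- start of `l`, hence of the start of `u`; yet at `a ≥ b` it meets `U`, weakly west of the
      -- start of `u`.
      · by_contra! hle
        have m1 := height_sub_mono A hle
        have m2 := height_sub_mono U (by omega : a ≤ u - 1)
        have m3 := height_sub_mono L h1
        omega
      · have := Nat.find_min hex hi'
        omega
    · push Not at hex
      refine ⟨n + 1, by omega, ?_, fun i hi _ => hex i hi⟩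
      rw [height_of_le hA.1 (by omega), height_of_le hB.1 (by omega)]
      omega
  obtain ⟨y, hay, hyb, hdrop, -⟩ :=
    exists_drop_right (fun i => (height A i : ℤ) - height B i) hab (by omega)
  have hy := mem_sdiff_of_drop (by omega) hdrop
  have hy' := Finset.mem_sdiff.1 hy
  refine ⟨y, hy, Finset.insert_subset (hB.1 hy'.1) hA.1, ?_, ?_, fun i => ?_⟩
  · rw [Finset.card_insert_of_notMem hy'.2]; omega
  · rw [Finset.card_insert_of_notMem hy'.2]; omega
  · rw [height_insert hy'.2]
    have := hb i
    have := ha' i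
    have := hb' i
    split_ifs <;> omega

theorem exchange_add_add (hg : IsGood U L u l) (hU : U ⊆ Finset.Icc 1 n)
    (hL : L ⊆ Finset.Icc 1 n) {A B : Finset ℕ} (hA : LiesBetween n (U.erase u) (L.erase l) A)
    (hB : LiesBetween n U L B) {x : ℕ} (hx : x ∈ A) (hx' : x ∉ B) :
    ∃ y ∈ B \ A, LiesBetween n (U.erase u) (L.erase l) (insert y (A.erase x)) := by
  obtain ⟨hc, hb⟩ := hA.erase_bounds hg.mem_upper hg.mem_lower
  have hu := Finset.mem_Icc.1 (hU hg.mem_upper)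
  have hl := Finset.mem_Icc.1 (hL hg.mem_lower)
  have hxn := Finset.mem_Icc.1 (hA.1 hx)
  have hs := height_sub_succ hxn.1 hx hx'
  have hBc := hB.2.2.1
  have hn := hg.north
  have eU := height_pred U hu.1
  rw [if_pos hg.mem_upper] at eU
  have hLe : ∀ i, height (L.erase l) i ≤ height L i :=
    height_subset (Finset.erase_subset _ _)
  have hUe : ∀ i, height U i ≤ height (U.erase u) i + 1 ∧
      (i < u → height U i ≤ height (U.erase u) i) := fun i => by
    have := height_erase hg.mem_upper i
    split_ifs at this <;> omega
  -- First case: the lower bound never obstructs a move to the right. Since `A` has one element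
  -- fewer than `B`, the difference ends at `-1`; if it does not fall below its value at `x`, it is
  -- at most `-2` just before `x`, which pays for the loss of one in the upper bound when moving
  -- left.
  by_cases hr : (∀ i, x ≤ i → i < n + 1 →
      (height A x : ℤ) - height B x ≤ height A i - height B i →
      height (L.erase l) i + 1 ≤ height A i)
  · by_cases hd : (height A (n + 1) : ℤ) - height B (n + 1) < height A x - height B x
    · exact hA.exists_swap_right hB.1 hx (m := n + 1) (by omega) hd hr
    · rw [height_of_le hA.1 (by omega), height_of_le hB.1 (by omega)] at hd
      refine hA.exists_swap_left hB.1 hx (a := 0) (by omega) ?_ fun j hj hj' hd' => ?_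
      · rw [height_zero hA.1, height_zero hB.1]; omega
      · have := (hB.2.2.2 j).2
        have := (hUe j).1
        omega
  · push Not at hr
    obtain ⟨i, hxi, hin, hdi, hi⟩ := hr
    have hLi := (hB.2.2.2 i).1
    have hLi' := height_erase hg.mem_lower i
    refine hA.exists_swap_left hB.1 hx (a := 0) (by omega) ?_ fun j hj hj' hd' => ?_
    · rw [height_zero hA.1, height_zero hB.1]
      split_ifs at hLi' <;> omega
    -- An obstruction on both sides would need `u ≤ j < x ≤ i < l`, with `A` touching the shortened
    -- upper path at `j` and `L` at `i`. Then `l` would start strictly higher than `u`, against the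
    -- northern half of goodness.
    · by_contra! hlt
      have hUj := (hB.2.2.2 j).2
      have hUj' := height_erase hg.mem_upper j
      have hAx := height_pred A hxn.1
      rw [if_pos hx] at hAx
      have m1 := height_mono A hxi
      have m2 := height_mono A (by omega : j ≤ x - 1)
      split_ifs at hLi' hUj' with c1 c2 c2
      · omega
      · omega
      · have m3 := height_mono L (by omega : i ≤ l - 1)
        have m4 := height_mono U c2
        omega
      · omega

/-- The matroid on `{0, 1, …, n}` whose deletion and contraction of `0` are the path matroids before
and after removing the pair `(u, l)`. -/
theorem exists_extension (h : Noncrossing n U L) (hg : IsGood U L u l) :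
    ∃ N : Matroid ℕ, N.E = (insert 0 (Finset.Icc 1 n) : Finset ℕ) ∧
      ∀ S : Finset ℕ, N.IsBase (S : Set ℕ) ↔ LiesBetween n U L S ∨
        ∃ A, LiesBetween n (U.erase u) (L.erase l) A ∧ S = insert 0 A := by
  have h0 : ∀ {A : Finset ℕ}, A ⊆ Finset.Icc 1 n → 0 ∉ A := fun hA h0 => by
    have := Finset.mem_Icc.1 (hA h0); omega
  refine exists_matroid_of_finset_bases _ _ ⟨U, Or.inl h.upper⟩ ?_ ?_
  · rintro S (hS | ⟨A, hA, rfl⟩)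
    · exact hS.1.trans (Finset.subset_insert _ _)
    · exact Finset.insert_subset_insert _ hA.1
  · rintro S T (hS | ⟨A, hA, rfl⟩) (hT | ⟨B, hB, rfl⟩) x hx hx'
    · obtain ⟨y, hy, hP⟩ := hS.exchange hT hx hx'
      exact ⟨y, hy, Or.inl hP⟩
    · rw [Finset.mem_insert, not_or] at hx'
      rcases exchange_delete_add h.1 hg.mem_upper hg.mem_lower hS hB hx hx'.2 with hP | ⟨y, hy, hP⟩
      · exact ⟨0, by simp [h0 hS.1], Or.inr ⟨_, hP, rfl⟩⟩
      · rw [Finset.mem_sdiff] at hy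
        exact ⟨y, by simp [hy.1, hy.2], Or.inl hP⟩
    · rcases Finset.mem_insert.1 hx with rfl | hx
      · obtain ⟨y, hy, hP⟩ := exchange_add_delete hg h.1 h.2.1 hA hT
        rw [Finset.mem_sdiff] at hy
        refine ⟨y, ?_, Or.inl ?_⟩
        · have : y ≠ 0 := by rintro rfl; exact h0 hT.1 hy.1
          simp [hy.1, hy.2, this]
        · rwa [Finset.erase_insert (h0 hA.1)]
      · obtain ⟨y, hy, hP⟩ := exchange_add_add hg h.1 h.2.1 hA hT hx hx'
        rw [Finset.mem_sdiff] at hy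
        have hy0 : y ≠ 0 := by rintro rfl; exact h0 hT.1 hy.1
        have hx0 : x ≠ 0 := by rintro rfl; exact h0 hA.1 hx
        refine ⟨y, by simp [hy.1, hy.2, hy0], Or.inr ⟨_, hP, ?_⟩⟩
        rw [Finset.erase_insert_of_ne hx0.symm, Finset.insert_comm]
    · rw [Finset.mem_insert, not_or] at hx'
      have hxA := (Finset.mem_insert.1 hx).resolve_left hx'.1
      obtain ⟨y, hy, hP⟩ := hA.exchange hB hxA hx'.2
      rw [Finset.mem_sdiff] at hy
      have hy0 : y ≠ 0 := by rintro rfl; exact h0 hB.1 hy.1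
      refine ⟨y, by simp [hy.1, hy.2, hy0], Or.inr ⟨_, hP, ?_⟩⟩
      rw [Finset.erase_insert_of_ne (Ne.symm hx'.1), Finset.insert_comm]

/-- In the extension, 0 is neither a loop nor a coloop, so the bases of the deletion are those
avoiding 0 and the bases of the contraction are those containing 0, with 0 removed. -/
theorem IsPathMatroid.isQuotient_erase {M M' : Matroid ℕ} (hM : IsPathMatroid n U L M)
    (hM' : IsPathMatroid n (U.erase u) (L.erase l) M') (hg : IsGood U L u l) :
    IsQuotient M' M := by
  obtain ⟨N, hE, hN⟩ := exists_extension hM.noncrossing hg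
  have h0 : ∀ {A : Finset ℕ}, A ⊆ Finset.Icc 1 n → 0 ∉ A := fun hA h0 => by
    have := Finset.mem_Icc.1 (hA h0); omega
  have hground : N.E \ {0} = Set.Icc 1 n := by
    ext x
    simp only [hE, Finset.coe_insert, Finset.coe_Icc, Set.mem_sdiff, Set.mem_insert_iff,
      Set.mem_Icc, Set.mem_singleton_iff]
    omega
  have hind : N.Indep {0} := by
    have hb := (hN _).2 (Or.inr ⟨_, hM'.noncrossing.upper, rfl⟩)
    exact hb.indep.subset (by simp)
  have hcoind : N.Coindep {0} := by
    rw [Matroid.coindep_iff_exists (by simp [hE])]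
    exact ⟨U, (hN U).2 (Or.inl hM.noncrossing.upper), by
      rw [hground, ← Finset.coe_Icc]; exact_mod_cast hM.noncrossing.1⟩
  refine ⟨N, {0}, hE ▸ Finset.finite_toSet _, by simp [hE], ?_, ?_⟩
  · refine Matroid.ext_isBase (by rw [Matroid.delete_ground, hground, hM.ground]) fun B hB => ?_
    rw [hM.ground] at hB
    lift B to Finset ℕ using (Set.finite_Icc 1 n).subset hB
    have hB' : B ⊆ Finset.Icc 1 n := by rwa [← Finset.coe_Icc, Finset.coe_subset] at hB
    rw [hcoind.delete_isBase_iff, hN, hM.isBase_iff]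
    constructor
    · exact fun h => ⟨Or.inl h, by
        rw [Set.disjoint_singleton_right]; exact_mod_cast h0 hB'⟩
    · rintro ⟨h | ⟨A, -, rfl⟩, -⟩
      · exact h
      · exact absurd (Finset.mem_insert_self 0 A) (h0 hB')
  · refine Matroid.ext_isBase (by rw [Matroid.contract_ground, hground, hM'.ground])
      fun B hB => ?_
    rw [hM'.ground] at hB
    lift B to Finset ℕ using (Set.finite_Icc 1 n).subset hB
    have hB' : B ⊆ Finset.Icc 1 n := by rwa [← Finset.coe_Icc, Finset.coe_subset] at hB
    have e : ((B : Set ℕ) ∪ {0}) = ((insert 0 B : Finset ℕ) : Set ℕ) := by simp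
    rw [hind.contract_isBase_iff, e, hN, hM'.isBase_iff]
    constructor
    · exact fun h => ⟨Or.inr ⟨B, h, rfl⟩, by
        rw [Set.disjoint_singleton_right]; exact_mod_cast h0 hB'⟩
    · rintro ⟨h | ⟨A, hA, hAB⟩, -⟩
      · exact absurd (Finset.mem_insert_self 0 B) (h0 h.1)
      · have : B = A := by
          rw [← Finset.erase_insert (h0 hB'), hAB, Finset.erase_insert (h0 hA.1)]
        rwa [this]

end Elementary

/-! ### Quotients of lattice path matroids -/

section Quotient

variable {n : ℕ} {U L U' L' : Finset ℕ} {M M' : Matroid ℕ}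

theorem height_add_height_sdiff {A B : Finset ℕ} (h : A ⊆ B) (i : ℕ) :
    height A i + height (B \ A) i = height B i := by
  unfold height
  rw [← Finset.card_union_of_disjoint, ← Finset.filter_union, Finset.union_sdiff_of_subset h]
  exact Finset.disjoint_filter_filter Finset.disjoint_sdiff

/-- Otherwise some basis would contain `i` and all earlier steps of `U`, and would rise above `U` at
`i`. The lower version is the same count from the other end. -/
theorem IsPathMatroid.mem_closure_upper (hM : IsPathMatroid n U L M) {i : ℕ}
    (hi : i ∈ Finset.Icc 1 n) (hiU : i ∉ U) : i ∈ M.closure (U.filter (· < i) : Finset ℕ) := by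
  have hi' := Finset.mem_Icc.1 hi
  by_contra hcl
  have hU := (hM.isBase_iff U).2 hM.noncrossing.upper
  have hI : M.Indep (U.filter (· < i) : Finset ℕ) :=
    hU.indep.subset (by exact_mod_cast Finset.filter_subset _ _)
  have hiE : i ∈ M.E := by rw [hM.ground]; exact hi'
  obtain ⟨B, hB, hIB⟩ := ((hI.notMem_closure_iff hiE).1 hcl).1.exists_isBase_superset
  lift B to Finset ℕ using (Set.finite_Icc 1 n).subset (hM.ground ▸ hB.subset_ground)
  have h1 := ((hM.isBase_iff B).1 hB).2.2.2 i
  have hsub : insert i (U.filter (· < i)) ⊆ B.filter (· ≤ i) := by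
    intro x hx
    have hxB : x ∈ B := by exact_mod_cast hIB (by exact_mod_cast hx)
    simp only [Finset.mem_insert, Finset.mem_filter] at hx ⊢
    exact ⟨hxB, by omega⟩
  have h2 := Finset.card_le_card hsub
  rw [Finset.card_insert_of_notMem (by simp)] at h2
  have h3 : (U.filter (· < i)).card = height U i := by
    unfold height
    congr 1
    ext x
    simp only [Finset.mem_filter]
    refine and_congr_right fun hx => ⟨le_of_lt, fun h => lt_of_le_of_ne h ?_⟩
    rintro rfl
    exact hiU hx
  have h4 : (B.filter (· ≤ i)).card = height B i := rfl
  omega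

theorem IsPathMatroid.mem_closure_lower (hM : IsPathMatroid n U L M) {i : ℕ}
    (hi : i ∈ Finset.Icc 1 n) (hiL : i ∉ L) : i ∈ M.closure (L.filter (i < ·) : Finset ℕ) := by
  have hi' := Finset.mem_Icc.1 hi
  by_contra hcl
  have hL := (hM.isBase_iff L).2 hM.noncrossing.lower
  have hI : M.Indep (L.filter (i < ·) : Finset ℕ) :=
    hL.indep.subset (by exact_mod_cast Finset.filter_subset _ _)
  have hiE : i ∈ M.E := by rw [hM.ground]; exact hi'
  obtain ⟨B, hB, hIB⟩ := ((hI.notMem_closure_iff hiE).1 hcl).1.exists_isBase_superset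
  lift B to Finset ℕ using (Set.finite_Icc 1 n).subset (hM.ground ▸ hB.subset_ground)
  have hB' := (hM.isBase_iff B).1 hB
  have h1 := hB'.2.2.2 (i - 1)
  have hsub : insert i (L.filter (i < ·)) ⊆ B.filter (fun x => ¬ x ≤ i - 1) := by
    intro x hx
    have hxB : x ∈ B := by exact_mod_cast hIB (by exact_mod_cast hx)
    simp only [Finset.mem_insert, Finset.mem_filter] at hx ⊢
    exact ⟨hxB, by omega⟩
  have h2 := Finset.card_le_card hsub
  rw [Finset.card_insert_of_notMem (by simp)] at h2
  have h3 := Finset.card_filter_add_card_filter_not (s := B) (· ≤ i - 1)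
  have h4 := Finset.card_filter_add_card_filter_not (s := L) (· ≤ i)
  simp only [not_le] at h2 h3 h4
  have h5 : (B.filter (· ≤ i - 1)).card = height B (i - 1) := rfl
  have h6 : (L.filter (· ≤ i)).card = height L i := rfl
  have h7 := height_pred L hi'.1
  rw [if_neg hiL] at h7
  have := hB'.2.1
  omega

/-- Closures grow under quotients, so a step `i` of `U'` missing from `U` would be spanned in `M'`
by the earlier steps of `U`, hence by the earlier steps of `U'`, contradicting independence of `U'`.
-/
theorem IsPathMatroid.upper_subset (hM : IsPathMatroid n U L M) (hM' : IsPathMatroid n U' L' M')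
    (hq : IsQuotient M' M) : U' ⊆ U := by
  intro i hi
  by_contra hiU
  have h1 := hq.closure_subset _ (hM.mem_closure_upper (hM'.1 hi) hiU)
  have h2 : ((U.filter (· < i) : Finset ℕ) : Set ℕ) ⊆
      M'.closure (U'.filter (· < i) : Finset ℕ) := by
    intro j hj
    have hj' := Finset.mem_filter.1 (Finset.mem_coe.1 hj)
    have hjn := hM.1 hj'.1
    by_cases hjU : j ∈ U'
    · refine M'.subset_closure _ ?_ (by simp [hjU, hj'.2])
      rw [hM'.ground, ← Finset.coe_Icc]
      exact_mod_cast (Finset.filter_subset _ _).trans hM'.1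
    · refine M'.closure_subset_closure ?_ (hM'.mem_closure_upper hjn hjU)
      intro x hx
      simp only [Finset.coe_filter, Set.mem_ofPred_eq] at hx ⊢
      exact ⟨hx.1, hx.2.trans hj'.2⟩
  have h3 := M'.closure_subset_closure_of_subset_closure h2 h1
  have hind := ((hM'.isBase_iff U').2 hM'.noncrossing.upper).indep
  refine hind.notMem_closure_sdiff_of_mem (by exact_mod_cast hi)
    (M'.closure_subset_closure ?_ h3)
  intro x hx
  simp only [Finset.coe_filter, Set.mem_ofPred_eq] at hx
  exact ⟨hx.1, by simpa using hx.2.ne⟩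

theorem IsPathMatroid.lower_subset (hM : IsPathMatroid n U L M) (hM' : IsPathMatroid n U' L' M')
    (hq : IsQuotient M' M) : L' ⊆ L := by
  intro i hi
  by_contra hiL
  have h1 := hq.closure_subset _ (hM.mem_closure_lower (hM'.2.1 hi) hiL)
  have h2 : ((L.filter (i < ·) : Finset ℕ) : Set ℕ) ⊆
      M'.closure (L'.filter (i < ·) : Finset ℕ) := by
    intro j hj
    have hj' := Finset.mem_filter.1 (Finset.mem_coe.1 hj)
    have hjn := hM.2.1 hj'.1
    by_cases hjL : j ∈ L'
    · refine M'.subset_closure _ ?_ (by simp [hjL, hj'.2])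
      rw [hM'.ground, ← Finset.coe_Icc]
      exact_mod_cast (Finset.filter_subset _ _).trans hM'.2.1
    · refine M'.closure_subset_closure ?_ (hM'.mem_closure_lower hjn hjL)
      intro x hx
      simp only [Finset.coe_filter, Set.mem_ofPred_eq] at hx ⊢
      exact ⟨hx.1, hj'.2.trans hx.2⟩
  have h3 := M'.closure_subset_closure_of_subset_closure h2 h1
  have hind := ((hM'.isBase_iff L').2 hM'.noncrossing.lower).indep
  refine hind.notMem_closure_sdiff_of_mem (by exact_mod_cast hi)
    (M'.closure_subset_closure ?_ h3)
  intro x hx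
  simp only [Finset.coe_filter, Set.mem_ofPred_eq] at hx
  exact ⟨hx.1, by simpa using hx.2.ne'⟩

/-- A basis of `M` spans the quotient because closures grow. Dually, the next lemma uses that
independence in the quotient implies independence in `M`. -/
theorem IsPathMatroid.exists_path_subset (hM : IsPathMatroid n U L M)
    (hM' : IsPathMatroid n U' L' M') (hq : IsQuotient M' M) {B : Finset ℕ}
    (hB : LiesBetween n U L B) : ∃ B' ⊆ B, LiesBetween n U' L' B' := by
  have hB1 := (hM.isBase_iff B).2 hB
  have hsp : M'.Spanning (B : Set ℕ) := by
    rw [Matroid.spanning_iff_ground_subset_closure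
      (by rw [hq.ground_eq]; exact hB1.subset_ground), hq.ground_eq, ← hB1.closure_eq]
    exact hq.closure_subset _
  obtain ⟨B', hB', hsub⟩ := hsp.exists_isBase_subset
  lift B' to Finset ℕ using B.finite_toSet.subset hsub
  exact ⟨B', by exact_mod_cast hsub, (hM'.isBase_iff B').1 hB'⟩

theorem IsPathMatroid.exists_path_superset (hM : IsPathMatroid n U L M)
    (hM' : IsPathMatroid n U' L' M') (hq : IsQuotient M' M) {B' : Finset ℕ}
    (hB' : LiesBetween n U' L' B') : ∃ B, B' ⊆ B ∧ LiesBetween n U L B := by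
  have hB1 := ((hM'.isBase_iff B').2 hB').indep
  have hind : M.Indep (B' : Set ℕ) := by
    rw [Matroid.indep_iff_forall_notMem_closure_sdiff (hq.ground_eq ▸ hB1.subset_ground)]
    intro e he hc
    exact hB1.notMem_closure_sdiff_of_mem he (hq.closure_subset _ hc)
  obtain ⟨B, hB, hsub⟩ := hind.exists_isBase_superset
  lift B to Finset ℕ using (Set.finite_Icc 1 n).subset (hM.ground ▸ hB.subset_ground)
  exact ⟨B, by exact_mod_cast hsub, (hM.isBase_iff B).1 hB⟩

theorem Noncrossing.exists_liesBetween (h : Noncrossing n U L) {g : ℕ → ℕ}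
    (hg : ∀ i, g i ≤ g (i + 1) ∧ g (i + 1) ≤ g i + 1)
    (hb : ∀ i, height L i ≤ g i ∧ g i ≤ height U i) :
    ∃ B, LiesBetween n U L B ∧ ∀ i ≤ n, height B i = g i := by
  have h0 : g 0 = 0 := by
    have := (hb 0).2
    rw [height_zero h.1] at this
    omega
  obtain ⟨B, hB, hgB⟩ := exists_height_eq n h0 hg
  have hn := hb n
  rw [height_of_le h.1 le_rfl, height_of_le h.2.1 le_rfl, ← hgB n le_rfl,
    height_of_le hB le_rfl] at hn
  have hc := h.2.2.1
  refine ⟨B, ⟨hB, by omega, by omega, fun i => ?_⟩, hgB⟩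
  rcases le_total i n with hi | hi
  · rw [hgB i hi]; exact hb i
  · rw [height_of_le h.1 hi, height_of_le h.2.1 hi, height_of_le hB hi]
    omega

theorem height_succ_bounds (A : Finset ℕ) (i : ℕ) :
    height A i ≤ height A (i + 1) ∧ height A (i + 1) ≤ height A i + 1 := by
  rw [height_succ]
  split_ifs <;> omega

/-- A path through a point of the lower path and a later point of the upper path. -/
theorem Noncrossing.exists_path_lower_upper (h : Noncrossing n U L) {i j : ℕ} (hij : i ≤ j)
    (hjn : j ≤ n) (hh : height U j ≤ height L i + (j - i)) :
    ∃ B, LiesBetween n U L B ∧ height B i = height L i ∧ height B j = height U j := by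
  -- Clamp between `L` and `U` the line that goes straight north through the point of `L` at time
  -- `i`; `hh` says that it has reached `U` by time `j`. The next lemma clamps a horizontal line
  -- instead.
  obtain ⟨B, hB, hg⟩ := h.exists_liesBetween
    (g := fun m => max (height L m) (min (height U m) (height L i + m - i)))
    (fun m => by
      have := height_succ_bounds L m
      have := height_succ_bounds U m
      omega)
    (fun m => by have := h.2.2.2 m; omega)
  refine ⟨B, hB, ?_, ?_⟩
  · rw [hg i (by omega)]; have := h.2.2.2 i; omega
  · rw [hg j hjn]; have := h.2.2.2 j; omega

/-- A path through a point of the upper path and a later point of the lower path. -/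
theorem Noncrossing.exists_path_upper_lower (h : Noncrossing n U L) {i j : ℕ} (hij : i ≤ j)
    (hjn : j ≤ n) (hh : height U i ≤ height L j) :
    ∃ B, LiesBetween n U L B ∧ height B i = height U i ∧ height B j = height L j := by
  obtain ⟨B, hB, hg⟩ := h.exists_liesBetween
    (g := fun m => max (height L m) (min (height U m) (height U i)))
    (fun m => by
      have := height_succ_bounds L m
      have := height_succ_bounds U m
      omega)
    (fun m => by have := h.2.2.2 m; omega)
  refine ⟨B, hB, ?_, ?_⟩
  · rw [hg i (by omega)]; have := h.2.2.2 i; omega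
  · rw [hg j hjn]; have := height_mono U hij; omega

/-- Let `k` be the common number of removed steps before `u` and before `l`. If the northern
condition fails, some path `B` of `M` meets `U` at `u` and `L` at `l - 1`. For a path `B' ⊆ B` of
`M'`, the set `B \ B'` has at least `k + 1` elements up to `u` but at most `k` up to the later time
`l - 1`. If the western condition fails, the same contradiction comes from a path of `M'` meeting
`L'` at `l` and `U'` at `u - 1`, extended to a path of `M`. -/
theorem IsPathMatroid.isGood (hM : IsPathMatroid n U L M)
    (hM' : IsPathMatroid n U' L' M') (hq : IsQuotient M' M) {u l : ℕ} (hu : u ∈ U \ U')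
    (hl : l ∈ L \ L') (hul : height (U \ U') (u - 1) = height (L \ L') (l - 1)) :
    IsGood U L u l := by
  have hUs := hM.upper_subset hM' hq
  have hLs := hM.lower_subset hM' hq
  have hu' := Finset.mem_sdiff.1 hu
  have hl' := Finset.mem_sdiff.1 hl
  have hun := Finset.mem_Icc.1 (hM.1 hu'.1)
  have hln := Finset.mem_Icc.1 (hM.2.1 hl'.1)
  have hU1 := height_add_height_sdiff hUs (u - 1)
  have hL1 := height_add_height_sdiff hLs (l - 1)
  have eU := height_pred U hun.1
  have eU' := height_pred U' hun.1
  have eL := height_pred L hln.1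
  have eL' := height_pred L' hln.1
  rw [if_pos hu'.1] at eU
  rw [if_neg hu'.2] at eU'
  rw [if_pos hl'.1] at eL
  rw [if_neg hl'.2] at eL'
  refine ⟨hu'.1, hl'.1, ?_, ?_⟩
  · by_contra! hlt
    have hle : u - 1 < l - 1 := by
      by_contra! hle
      have := height_mono U hle
      have := hM.noncrossing.2.2.2 (l - 1)
      omega
    obtain ⟨B, hB, h1, h2⟩ := hM.noncrossing.exists_path_upper_lower (i := u) (j := l - 1)
      (by omega) (by omega) (by omega)
    obtain ⟨B', hsub, hB'⟩ := hM.exists_path_subset hM' hq hB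
    have s1 := height_add_height_sdiff hsub u
    have s2 := height_add_height_sdiff hsub (l - 1)
    have s3 := height_mono (B \ B') (by omega : u ≤ l - 1)
    have := (hB'.2.2.2 u).2
    have := (hB'.2.2.2 (l - 1)).1
    omega
  · by_contra! hlt
    have hle : l ≤ u - 1 := by
      by_contra! hle
      have := height_sub_mono L (by omega : u - 1 ≤ l - 1)
      have := hM.noncrossing.2.2.2 (u - 1)
      omega
    obtain ⟨B', hB', h1, h2⟩ := hM'.noncrossing.exists_path_lower_upper (i := l) (j := u - 1)
      hle (by omega) (by omega)
    obtain ⟨B, hsub, hB⟩ := hM.exists_path_superset hM' hq hB'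
    have s1 := height_add_height_sdiff hsub l
    have s2 := height_add_height_sdiff hsub (u - 1)
    have s3 := height_mono (B \ B') hle
    have := (hB.2.2.2 l).1
    have := (hB.2.2.2 (u - 1)).2
    omega

end Quotient

/-! ### Words of removals -/

theorem IsQuotient.trans {M₁ M₂ M₃ : Matroid ℕ} (h₁ : IsQuotient M₁ M₂) (h₂ : IsQuotient M₂ M₃)
    (hfin : M₃.E.Finite) : IsQuotient M₁ M₃ :=
  isQuotient_of_closure_subset (h₁.ground_eq.trans h₂.ground_eq) hfin
    fun X => (h₂.closure_subset X).trans (h₁.closure_subset X)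

/-- `Removes U L w U' L'`: successively removing the pairs of the word `w`, each of them good at the
time of its removal, leads from the pair of paths `(U, L)` to the pair `(U', L')`. -/
def Removes : Finset ℕ → Finset ℕ → List (ℕ × ℕ) → Finset ℕ → Finset ℕ → Prop
  | U, L, [], U', L' => U = U' ∧ L = L'
  | U, L, p :: w, U', L' => IsGood U L p.1 p.2 ∧ Removes (U.erase p.1) (L.erase p.2) w U' L'

section Removes

variable {n : ℕ} {U L U' L' : Finset ℕ} {v w : List (ℕ × ℕ)} {M M' : Matroid ℕ}

theorem removes_append : Removes U L (v ++ w) U' L' ↔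
    ∃ U₁ L₁, Removes U L v U₁ L₁ ∧ Removes U₁ L₁ w U' L' := by
  induction v generalizing U L with
  | nil =>
    constructor
    · exact fun h => ⟨U, L, ⟨rfl, rfl⟩, h⟩
    · rintro ⟨_, _, ⟨rfl, rfl⟩, h⟩
      exact h
  | cons p v ih =>
    simp only [List.cons_append, Removes, ih]
    constructor
    · rintro ⟨h, U₁, L₁, h1, h2⟩
      exact ⟨U₁, L₁, ⟨h, h1⟩, h2⟩
    · rintro ⟨U₁, L₁, ⟨h, h1⟩, h2⟩
      exact ⟨h, U₁, L₁, h1, h2⟩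

theorem Removes.unique {U₁ L₁ U₂ L₂ : Finset ℕ} (h₁ : Removes U L w U₁ L₁)
    (h₂ : Removes U L w U₂ L₂) : U₁ = U₂ ∧ L₁ = L₂ := by
  induction w generalizing U L with
  | nil => exact ⟨h₁.1.symm.trans h₂.1, h₁.2.symm.trans h₂.2⟩
  | cons p w ih => exact ih h₁.2 h₂.2

theorem Removes.noncrossing (h : Removes U L w U' L') (hn : Noncrossing n U L) :
    Noncrossing n U' L' := by
  induction w generalizing U L with
  | nil => obtain ⟨rfl, rfl⟩ := h; exact hn
  | cons p w ih => exact ih h.2 (hn.erase h.1)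

theorem Removes.isQuotient (h : Removes U L w U' L') (hM : IsPathMatroid n U L M)
    (hM' : IsPathMatroid n U' L' M') : IsQuotient M' M := by
  have hfin : M.E.Finite := hM.ground ▸ Set.finite_Icc 1 n
  induction w generalizing U L M with
  | nil =>
    obtain ⟨rfl, rfl⟩ := h
    rw [hM.eq hM']
    exact isQuotient_of_closure_subset rfl (hM.eq hM' ▸ hfin) fun _ => subset_rfl
  | cons p w ih =>
    obtain ⟨M₁, hM₁⟩ := (hM.noncrossing.erase h.1).exists_matroid
    exact (ih h.2 hM₁ (hM₁.ground ▸ Set.finite_Icc 1 n)).trans (hM.isQuotient_erase hM₁ h.1) hfin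

theorem Removes.upper (h : Removes U L w U' L') :
    U' ⊆ U ∧ (w.map Prod.fst).Nodup ∧ ∀ x, x ∈ w.map Prod.fst ↔ x ∈ U \ U' := by
  induction w generalizing U L with
  | nil => obtain ⟨rfl, rfl⟩ := h; simp
  | cons p w ih =>
    obtain ⟨h1, h2, h3⟩ := ih h.2
    have hp := h.1.mem_upper
    have hp' : p.1 ∉ U' := fun h' => by simpa using h1 h'
    refine ⟨h1.trans (Finset.erase_subset _ _), ?_, fun x => ?_⟩
    · rw [List.map_cons, List.nodup_cons, h3]
      exact ⟨by simp, h2⟩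
    · rw [List.map_cons, List.mem_cons, h3]
      simp only [Finset.mem_sdiff, Finset.mem_erase]
      grind

theorem Removes.lower (h : Removes U L w U' L') :
    L' ⊆ L ∧ (w.map Prod.snd).Nodup ∧ ∀ x, x ∈ w.map Prod.snd ↔ x ∈ L \ L' := by
  induction w generalizing U L with
  | nil => obtain ⟨rfl, rfl⟩ := h; simp
  | cons p w ih =>
    obtain ⟨h1, h2, h3⟩ := ih h.2
    have hp := h.1.mem_lower
    have hp' : p.2 ∉ L' := fun h' => by simpa using h1 h'
    refine ⟨h1.trans (Finset.erase_subset _ _), ?_, fun x => ?_⟩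
    · rw [List.map_cons, List.nodup_cons, h3]
      exact ⟨by simp, h2⟩
    · rw [List.map_cons, List.mem_cons, h3]
      simp only [Finset.mem_sdiff, Finset.mem_erase]
      grind

theorem Removes.card_eq (h : Removes U L w U' L') : U.card = U'.card + w.length := by
  induction w generalizing U L with
  | nil => obtain ⟨rfl, rfl⟩ := h; simp
  | cons p w ih =>
    have := ih h.2
    have := Finset.card_erase_add_one h.1.mem_upper
    rw [List.length_cons]
    omega

/-- The pair `q` exceeds the pair `p` in both coordinates. -/
def Ascends (p q : ℕ × ℕ) : Prop := p.1 < q.1 ∧ p.2 < q.2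

instance : DecidableRel Ascends := fun _ _ => inferInstanceAs (Decidable (_ ∧ _))

instance : IsTrans (ℕ × ℕ) Ascends :=
  ⟨fun _ _ _ h₁ h₂ => ⟨h₁.1.trans h₂.1, h₁.2.trans h₂.2⟩⟩

theorem eq_of_sortedLT_of_mem_iff {a b : List ℕ} (ha : a.Pairwise (· < ·))
    (hb : b.Pairwise (· < ·)) (h : ∀ x, x ∈ a ↔ x ∈ b) : a = b := by
  have hp : a.Perm b := (List.perm_ext_iff_of_nodup (ha.imp ne_of_lt) (hb.imp ne_of_lt)).2 h
  exact hp.eq_of_pairwise (fun x y _ _ h1 h2 => absurd h1 h2.asymm) ha hb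

theorem Removes.ascending_unique (hv : Removes U L v U' L') (hw : Removes U L w U' L')
    (hv' : v.Pairwise Ascends) (hw' : w.Pairwise Ascends) : v = w := by
  have h1 : v.map Prod.fst = w.map Prod.fst := eq_of_sortedLT_of_mem_iff
    (List.pairwise_map.2 (hv'.imp fun h => h.1)) (List.pairwise_map.2 (hw'.imp fun h => h.1))
    fun x => by rw [hv.upper.2.2, hw.upper.2.2]
  have h2 : v.map Prod.snd = w.map Prod.snd := eq_of_sortedLT_of_mem_iff
    (List.pairwise_map.2 (hv'.imp fun h => h.2)) (List.pairwise_map.2 (hw'.imp fun h => h.2))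
    fun x => by rw [hv.lower.2.2, hw.lower.2.2]
  rw [← List.zip_unzip v, ← List.zip_unzip w, List.unzip_eq_map, List.unzip_eq_map, h1, h2]

/-! ### Existence of ascending words -/

theorem height_min_sub_one {A : Finset ℕ} {a : ℕ} (ha : ∀ x ∈ A, a ≤ x) (ha1 : 1 ≤ a) :
    height A (a - 1) = 0 := by
  rw [height, Finset.card_eq_zero, Finset.filter_eq_empty_iff]
  intro x hx
  have := ha x hx
  omega

/-- Remove the smallest elements of the two differences first. Every later matched pair stays good,
because both starting heights drop by exactly one. -/
theorem exists_ascending_word (hU : U ⊆ Finset.Icc 1 n) (hL : L ⊆ Finset.Icc 1 n)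
    (hUs : U' ⊆ U) (hLs : L' ⊆ L) (hc : (L \ L').card = (U \ U').card)
    (hgood : ∀ u ∈ U \ U', ∀ l ∈ L \ L',
      height (U \ U') (u - 1) = height (L \ L') (l - 1) → IsGood U L u l) :
    ∃ w, Removes U L w U' L' ∧ w.Pairwise Ascends := by
  induction hk : (U \ U').card generalizing U L with
  | zero =>
    have h1 : U ⊆ U' := Finset.sdiff_eq_empty_iff_subset.1 (Finset.card_eq_zero.1 hk)
    have h2 : L ⊆ L' := Finset.sdiff_eq_empty_iff_subset.1 (Finset.card_eq_zero.1 (hc.trans hk))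
    exact ⟨[], ⟨h1.antisymm hUs, h2.antisymm hLs⟩, List.Pairwise.nil⟩
  | succ k ih =>
    have hne : (U \ U').Nonempty := Finset.card_pos.1 (by omega)
    have hne' : (L \ L').Nonempty := Finset.card_pos.1 (by omega)
    set u := (U \ U').min' hne with hu_def
    set l := (L \ L').min' hne' with hl_def
    have hu : u ∈ U \ U' := Finset.min'_mem _ _
    have hl : l ∈ L \ L' := Finset.min'_mem _ _
    have humin : ∀ x ∈ U \ U', u ≤ x := fun x hx => Finset.min'_le _ _ hx
    have hlmin : ∀ x ∈ L \ L', l ≤ x := fun x hx => Finset.min'_le _ _ hx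
    have hu' := Finset.mem_sdiff.1 hu
    have hl' := Finset.mem_sdiff.1 hl
    have hun := Finset.mem_Icc.1 (hU hu'.1)
    have hln := Finset.mem_Icc.1 (hL hl'.1)
    have hg : IsGood U L u l := hgood u hu l hl (by
      rw [height_min_sub_one humin hun.1, height_min_sub_one hlmin hln.1])
    have eU : U.erase u \ U' = (U \ U').erase u := Finset.erase_sdiff_comm U U' u
    have eL : L.erase l \ L' = (L \ L').erase l := Finset.erase_sdiff_comm L L' l
    have hrec : ∀ a ∈ U.erase u \ U', ∀ b ∈ L.erase l \ L',
        height (U.erase u \ U') (a - 1) = height (L.erase l \ L') (b - 1) →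
        IsGood (U.erase u) (L.erase l) a b := by
      intro a ha b hb hab
      rw [eU] at ha hab
      rw [eL] at hb hab
      have ha' := Finset.mem_erase.1 ha
      have hb' := Finset.mem_erase.1 hb
      have h1 := humin a ha'.2
      have h2 := hlmin b hb'.2
      have e1 := height_erase hu (a - 1)
      have e2 := height_erase hl (b - 1)
      rw [if_pos (by have := ha'.1; omega)] at e1
      rw [if_pos (by have := hb'.1; omega)] at e2
      have hg' := hgood a ha'.2 b hb'.2 (by omega)
      have e3 := height_erase hu'.1 (a - 1)
      have e4 := height_erase hl'.1 (b - 1)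
      rw [if_pos (by have := ha'.1; omega)] at e3
      rw [if_pos (by have := hb'.1; omega)] at e4
      have := hg'.north
      have := hg'.west
      exact ⟨Finset.mem_erase.2 ⟨ha'.1, hg'.mem_upper⟩, Finset.mem_erase.2 ⟨hb'.1, hg'.mem_lower⟩,
        by omega, by omega⟩
    obtain ⟨w, hw, hasc⟩ := ih (U := U.erase u) (L := L.erase l)
      ((Finset.erase_subset _ _).trans hU) ((Finset.erase_subset _ _).trans hL)
      (fun x hx => Finset.mem_erase.2 ⟨fun h => hu'.2 (h ▸ hx), hUs hx⟩)
      (fun x hx => Finset.mem_erase.2 ⟨fun h => hl'.2 (h ▸ hx), hLs hx⟩)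
      (by rw [eU, eL, Finset.card_erase_of_mem hu, Finset.card_erase_of_mem hl, hc]) hrec
      (by rw [eU, Finset.card_erase_of_mem hu, hk, Nat.add_sub_cancel])
    refine ⟨(u, l) :: w, ⟨hg, hw⟩, List.pairwise_cons.2 ⟨fun q hq => ?_, hasc⟩⟩
    have h1 := (hw.upper.2.2 q.1).1 (List.mem_map_of_mem hq)
    have h2 := (hw.lower.2.2 q.2).1 (List.mem_map_of_mem hq)
    rw [eU, Finset.mem_erase] at h1
    rw [eL, Finset.mem_erase] at h2
    exact ⟨lt_of_le_of_ne (humin _ h1.2) (Ne.symm h1.1),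
      lt_of_le_of_ne (hlmin _ h2.2) (Ne.symm h2.1)⟩

theorem IsPathMatroid.exists_ascending_word (hM : IsPathMatroid n U L M)
    (hM' : IsPathMatroid n U' L' M') (hq : IsQuotient M' M) :
    ∃ w, Removes U L w U' L' ∧ w.Pairwise Ascends := by
  have hUs := hM.upper_subset hM' hq
  have hLs := hM.lower_subset hM' hq
  refine LatticePathMatroid.exists_ascending_word hM.1 hM.2.1 hUs hLs ?_
    fun u hu l hl h => hM.isGood hM' hq hu hl h
  rw [Finset.card_sdiff_of_subset hUs, Finset.card_sdiff_of_subset hLs, hM.2.2.1, hM'.2.2.1]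

/-- Splitting a fixed nonempty word into an ascending part and a remaining part without ascents. -/
theorem sum_split_eq_zero {α : Type*} (R : α → α → Prop) [DecidableRel R] [IsTrans α R]
    {w : List α} (hw : w ≠ []) :
    ∑ i ∈ Finset.range (w.length + 1), (if (w.take i).Pairwise R ∧
      (w.drop i).IsChain (fun a b => ¬ R a b) then (-1 : ℤ) ^ i else 0) = 0 := by
  induction w with
  | nil => exact absurd rfl hw
  | cons p w ih =>
    rcases w with _ | ⟨q, w⟩
    · simp [Finset.sum_range_succ]
    · rw [List.length_cons, Finset.sum_range_succ']
      by_cases hpq : R p q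
      -- The cut at 0 leaves the ascent `p, q` in the second part, so it is not admissible; the
      -- other cuts are those of the tail, with opposite sign.
      · have h1 := ih (by simp)
        rw [← neg_eq_zero, ← Finset.sum_neg_distrib] at h1
        refine Eq.trans ?_ h1
        rw [if_neg (by simp [List.isChain_cons_cons, hpq]), add_zero]
        refine Finset.sum_congr rfl fun i hi => ?_
        rcases i with _ | i
        · simp only [List.drop_succ_cons, List.take_succ_cons, List.take_zero, List.drop_zero,
            List.pairwise_singleton, List.Pairwise.nil, true_and]
          split_ifs <;> simp
        · simp only [List.take_succ_cons, List.drop_succ_cons]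
          rw [pow_succ]
          have : (p :: q :: w.take i).Pairwise R ↔ (q :: w.take i).Pairwise R := by
            rw [List.pairwise_cons_cons_iff_of_trans, and_iff_right hpq]
          simp only [this]
          split_ifs <;> ring
      -- Only the cuts at 0 and 1 can be admissible; both are so exactly when `q :: w` is
      -- ascent-free, and they cancel.
      · rw [List.length_cons, Finset.sum_range_succ', Finset.sum_eq_zero]
        · simp [List.isChain_cons_cons, hpq]
          split_ifs <;> simp
        · intro i hi
          rw [if_neg]
          simp [hpq]

/-- The words of length `k` leading from `(U, L)` to `(∅, ∅)`. -/
noncomputable def words : ℕ → Finset ℕ → Finset ℕ → Finset (List (ℕ × ℕ))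
  | 0, U, L => open Classical in if U = ∅ ∧ L = ∅ then {[]} else ∅
  | k + 1, U, L => open Classical in ((U ×ˢ L).filter fun p => IsGood U L p.1 p.2).biUnion
      fun p => (words k (U.erase p.1) (L.erase p.2)).image (p :: ·)

theorem mem_words {k : ℕ} : w ∈ words k U L ↔ w.length = k ∧ Removes U L w ∅ ∅ := by
  classical
  induction k generalizing U L w with
  | zero =>
    rw [words, List.length_eq_zero_iff]
    split_ifs with h
    · rw [Finset.mem_singleton]
      exact ⟨fun hw => ⟨hw, hw ▸ h⟩, fun hw => hw.1⟩
    · simp only [Finset.notMem_empty, false_iff]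
      rintro ⟨rfl, hw⟩
      exact h hw
  | succ k ih =>
    simp only [words, Finset.mem_biUnion, Finset.mem_filter, Finset.mem_image, ih]
    constructor
    · rintro ⟨p, ⟨-, hp⟩, w, ⟨rfl, hw⟩, rfl⟩
      exact ⟨rfl, hp, hw⟩
    · rcases w with _ | ⟨p, w⟩
      · simp
      · rintro ⟨hl, hp, hw⟩
        exact ⟨p, ⟨Finset.mem_product.2 ⟨hp.mem_upper, hp.mem_lower⟩, hp⟩, w,
          ⟨by simpa using hl, hw⟩, rfl⟩

end Removes

/-! ### The Möbius function from the bottom element -/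

namespace LPM

variable {n : ℕ}

/-- The upper path of a lattice path matroid. -/
noncomputable def upper (M : LPM n) : Finset ℕ := M.2.choose

/-- The lower path of a lattice path matroid. -/
noncomputable def lower (M : LPM n) : Finset ℕ := M.2.choose_spec.choose

theorem isPathMatroid (M : LPM n) : IsPathMatroid n M.upper M.lower M.1 :=
  M.2.choose_spec.choose_spec

theorem le_iff {M' M : LPM n} : M' ≤ M ↔
    ∃ w, Removes M.upper M.lower w M'.upper M'.lower ∧ w.Pairwise Ascends :=
  ⟨fun h => M.isPathMatroid.exists_ascending_word M'.isPathMatroid h,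
    fun ⟨_, hw, _⟩ => hw.isQuotient M.isPathMatroid M'.isPathMatroid⟩

theorem le_of_removes {M' M : LPM n} {w : List (ℕ × ℕ)}
    (hw : Removes M.upper M.lower w M'.upper M'.lower) : M' ≤ M :=
  hw.isQuotient M.isPathMatroid M'.isPathMatroid

theorem ext_paths {M M' : LPM n} (hU : M.upper = M'.upper) (hL : M.lower = M'.lower) :
    M = M' :=
  Subtype.ext (M.isPathMatroid.eq (by rw [hU, hL]; exact M'.isPathMatroid))

theorem exists_of_noncrossing {U L : Finset ℕ} (h : Noncrossing n U L) :
    ∃ M : LPM n, M.upper = U ∧ M.lower = L := by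
  obtain ⟨M, hM⟩ := h.exists_matroid
  let M' : LPM n := ⟨M, U, L, hM⟩
  exact ⟨M', M'.isPathMatroid.paths_eq hM⟩

theorem uniformZero_paths (n : ℕ) : (uniformZero n).upper = ∅ ∧ (uniformZero n).lower = ∅ := by
  have h := (uniformZero n).isPathMatroid
  have hU := (h.isBase_iff _).2 h.noncrossing.upper
  have hL := (h.isBase_iff _).2 h.noncrossing.lower
  simp only [uniformZero, Matroid.loopyOn_isBase_iff, Finset.coe_eq_empty] at hU hL
  exact ⟨hU, hL⟩

theorem uniformTop_paths (n : ℕ) :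
    (uniformTop n).upper = Finset.Icc 1 n ∧ (uniformTop n).lower = Finset.Icc 1 n := by
  have h := (uniformTop n).isPathMatroid
  have hU := (h.isBase_iff _).2 h.noncrossing.upper
  have hL := (h.isBase_iff _).2 h.noncrossing.lower
  have e : (uniformTop n).1 = Matroid.freeOn (Set.Icc 1 n) := rfl
  rw [e, Matroid.freeOn_isBase_iff, ← Finset.coe_Icc, Finset.coe_inj] at hU hL
  exact ⟨hU, hL⟩

/-- The words of removals from `M` to the bottom element. -/
noncomputable def descents (M : LPM n) : Finset (List (ℕ × ℕ)) :=
  words M.upper.card M.upper M.lower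

theorem mem_descents {M : LPM n} {w : List (ℕ × ℕ)} :
    w ∈ M.descents ↔ Removes M.upper M.lower w ∅ ∅ := by
  rw [descents, mem_words, and_iff_right_iff_imp]
  intro h
  simpa using h.card_eq.symm

theorem zero_le_of_removes {M : LPM n} {w : List (ℕ × ℕ)}
    (hw : Removes M.upper M.lower w ∅ ∅) : uniformZero n ≤ M :=
  le_of_removes (w := w) (by rwa [(uniformZero_paths n).1, (uniformZero_paths n).2])

/-- The words of removals from `M` to the bottom element without ascents. -/
noncomputable def ascentFree (M : LPM n) : Finset (List (ℕ × ℕ)) :=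
  M.descents.filter fun w => w.IsChain fun p q => ¬ Ascends p q

theorem mem_ascentFree {M : LPM n} {w : List (ℕ × ℕ)} : w ∈ M.ascentFree ↔
    Removes M.upper M.lower w ∅ ∅ ∧ w.IsChain fun p q => ¬ Ascends p q := by
  rw [ascentFree, Finset.mem_filter, mem_descents]

theorem sum_ascentFree_eq_zero {M : LPM n} (hM : M ≠ uniformZero n) :
    ∑ M' ∈ Finset.Icc (uniformZero n) M,
      (-1 : ℤ) ^ M'.upper.card * M'.ascentFree.card = 0 := by
  classical
  have hword : ∀ M' ∈ Finset.Icc (uniformZero n) M, ∃ a,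
      Removes M.upper M.lower a M'.upper M'.lower ∧ a.Pairwise Ascends := fun M' h =>
    le_iff.1 (Finset.mem_Icc.1 h).2
  choose! a ha ha' using hword
  calc ∑ M' ∈ Finset.Icc (uniformZero n) M, (-1 : ℤ) ^ M'.upper.card * M'.ascentFree.card
      = ∑ p ∈ (Finset.Icc (uniformZero n) M).sigma fun M' => M'.ascentFree,
          (-1 : ℤ) ^ M.upper.card * (-1) ^ (a p.1).length := by
        rw [Finset.sum_sigma]
        refine Finset.sum_congr rfl fun M' h => ?_
        dsimp only
        rw [Finset.sum_const, nsmul_eq_mul, mul_comm, (ha M' h).card_eq, pow_add, mul_assoc,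
          ← mul_pow]
        simp
    _ = ∑ q ∈ (M.descents.sigma fun w => Finset.range (w.length + 1)).filter fun q =>
          (q.1.take q.2).Pairwise Ascends ∧ (q.1.drop q.2).IsChain fun p q => ¬ Ascends p q,
          (-1 : ℤ) ^ M.upper.card * (-1) ^ q.2 := by
        -- The cut recovers `M'` as the endpoint of the prefix; surjectivity rests on uniqueness of
        -- the ascending word.
        refine Finset.sum_bij (fun p _ => ⟨a p.1 ++ p.2, (a p.1).length⟩) ?_ ?_ ?_ ?_
        · rintro ⟨M', v⟩ h
          obtain ⟨h1, h2⟩ := Finset.mem_sigma.1 h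
          obtain ⟨h3, h4⟩ := mem_ascentFree.1 h2
          simp only [Finset.mem_filter, Finset.mem_sigma, mem_descents, Finset.mem_range,
            List.length_append, List.take_left, List.drop_left]
          exact ⟨⟨removes_append.2 ⟨_, _, ha M' h1, h3⟩, by omega⟩, ha' M' h1, h4⟩
        · rintro ⟨M₁, v₁⟩ h₁ ⟨M₂, v₂⟩ h₂ heq
          have h1 := (Finset.mem_sigma.1 h₁).1
          have h2 := (Finset.mem_sigma.1 h₂).1
          simp only [Sigma.mk.injEq, heq_eq_eq] at heq
          obtain ⟨e1, e2⟩ := List.append_inj heq.1 heq.2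
          have r1 := ha M₁ h1
          rw [e1] at r1
          obtain ⟨e3, e4⟩ := r1.unique (ha M₂ h2)
          rw [e2, ext_paths e3 e4]
        · rintro ⟨w, i⟩ h
          simp only [Finset.mem_filter, Finset.mem_sigma, mem_descents, Finset.mem_range] at h
          obtain ⟨⟨hw, hi⟩, hasc, hdesc⟩ := h
          rw [← List.take_append_drop i w] at hw
          obtain ⟨U₁, L₁, h1, h2⟩ := removes_append.1 hw
          obtain ⟨M', rfl, rfl⟩ :=
            exists_of_noncrossing (h1.noncrossing M.isPathMatroid.noncrossing)
          have hM' : M' ∈ Finset.Icc (uniformZero n) M :=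
            Finset.mem_Icc.2 ⟨zero_le_of_removes h2, le_of_removes h1⟩
          have hu := (ha M' hM').ascending_unique h1 (ha' M' hM') hasc
          refine ⟨⟨M', w.drop i⟩, Finset.mem_sigma.2 ⟨hM', mem_ascentFree.2 ⟨h2, hdesc⟩⟩, ?_⟩
          simp only [hu, List.take_append_drop, List.length_take, Sigma.mk.injEq, heq_eq_eq,
            true_and]
          omega
        · intro p _
          rfl
    _ = (-1 : ℤ) ^ M.upper.card * ∑ w ∈ M.descents, ∑ i ∈ Finset.range (w.length + 1),
          (if (w.take i).Pairwise Ascends ∧ (w.drop i).IsChain (fun p q => ¬ Ascends p q)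
            then (-1 : ℤ) ^ i else 0) := by
        rw [← Finset.mul_sum, Finset.sum_filter, Finset.sum_sigma]
    _ = 0 := by
        rw [Finset.sum_eq_zero, mul_zero]
        intro w hw
        refine sum_split_eq_zero Ascends ?_
        rintro rfl
        obtain ⟨h1, h2⟩ := mem_descents.1 hw
        exact hM (ext_paths (h1.trans (uniformZero_paths n).1.symm)
          (h2.trans (uniformZero_paths n).2.symm))

/-- Both sides equal 1 at the bottom and sum to zero over each nontrivial interval starting there.
-/
theorem mu_uniformZero (M : LPM n) (hM : uniformZero n ≤ M) :
    IncidenceAlgebra.mu ℤ (uniformZero n) M = (-1) ^ M.upper.card * M.ascentFree.card := by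
  induction M using (wellFounded_lt (α := LPM n)).induction with
  | _ M ih =>
    rcases eq_or_ne M (uniformZero n) with rfl | hne
    · have : (uniformZero n).ascentFree = {[]} := by
        ext w
        rw [mem_ascentFree, (uniformZero_paths n).1, (uniformZero_paths n).2, Finset.mem_singleton]
        constructor
        · rintro ⟨h, -⟩
          rcases w with _ | ⟨p, w⟩
          · rfl
          · simpa using h.1.mem_upper
        · rintro rfl
          exact ⟨⟨rfl, rfl⟩, List.isChain_nil⟩
      rw [IncidenceAlgebra.mu_self, this, (uniformZero_paths n).1]
      simp
    · have h := sum_ascentFree_eq_zero hne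
      rw [IncidenceAlgebra.mu_eq_neg_sum_Ico_of_ne hne.symm,
        Finset.sum_congr rfl fun M' h' => ih M' (Finset.mem_Ico.1 h').2 (Finset.mem_Ico.1 h').1]
      rw [← Finset.Ico_insert_right hM, Finset.sum_insert Finset.right_notMem_Ico] at h
      linarith

end LPM

/-! ### Words from the top element and pairs of permutations -/

/-- When a word ends at the empty paths, the paths before each removal consist exactly of the
entries still to come, which makes the recursion explicit. -/
theorem removes_iff {U L : Finset ℕ} {w : List (ℕ × ℕ)} : Removes U L w ∅ ∅ ↔
    (w.map Prod.fst).Nodup ∧ (w.map Prod.snd).Nodup ∧ U = (w.map Prod.fst).toFinset ∧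
      L = (w.map Prod.snd).toFinset ∧ ∀ j (hj : j < w.length),
        IsGood ((w.map Prod.fst).drop j).toFinset ((w.map Prod.snd).drop j).toFinset
          w[j].1 w[j].2 := by
  induction w generalizing U L with
  | nil => simp [Removes]
  | cons p w ih =>
    constructor
    · rintro ⟨hp, hw⟩
      obtain ⟨h1, h2, h3, h4, h5⟩ := ih.1 hw
      have e1 : U = insert p.1 (w.map Prod.fst).toFinset := by
        rw [← h3, Finset.insert_erase hp.mem_upper]
      have e2 : L = insert p.2 (w.map Prod.snd).toFinset := by
        rw [← h4, Finset.insert_erase hp.mem_lower]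
      have n1 : p.1 ∉ w.map Prod.fst := by rw [← List.mem_toFinset, ← h3]; simp
      have n2 : p.2 ∉ w.map Prod.snd := by rw [← List.mem_toFinset, ← h4]; simp
      refine ⟨List.nodup_cons.2 ⟨n1, h1⟩, List.nodup_cons.2 ⟨n2, h2⟩, by simpa using e1,
        by simpa using e2, fun j hj => ?_⟩
      rcases j with _ | j
      · rw [List.drop_zero, List.drop_zero, List.map_cons, List.map_cons, List.toFinset_cons,
          List.toFinset_cons, ← e1, ← e2]
        exact hp
      · exact h5 j (by simpa using hj)
    · rintro ⟨h1, h2, h3, h4, h5⟩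
      rw [List.map_cons, List.nodup_cons, ← List.mem_toFinset] at h1 h2
      rw [List.map_cons, List.toFinset_cons] at h3 h4
      refine ⟨?_, ih.2 ⟨h1.2, h2.2, ?_, ?_, fun j hj => ?_⟩⟩
      · have := h5 0 (by simp)
        rwa [List.drop_zero, List.drop_zero, List.map_cons, List.map_cons, List.toFinset_cons,
          List.toFinset_cons, ← h3, ← h4] at this
      · rw [h3, Finset.erase_insert h1.1]
      · rw [h4, Finset.erase_insert h2.1]
      · exact h5 (j + 1) (by simpa using hj)

theorem toFinset_drop_ofFn {n : ℕ} (f : Fin n → ℕ) (j : ℕ) :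
    ((List.ofFn f).drop j).toFinset = (Finset.univ.filter fun k : Fin n => j ≤ k.1).image f := by
  ext x
  simp only [List.mem_toFinset, List.mem_drop_iff_getElem, List.length_ofFn, List.getElem_ofFn,
    Finset.mem_image, Finset.mem_filter, Finset.mem_univ, true_and]
  constructor
  · rintro ⟨k, hk, rfl⟩
    exact ⟨⟨j + k, by omega⟩, by simp, rfl⟩
  · rintro ⟨k, hk, rfl⟩
    refine ⟨k.1 - j, by omega, ?_⟩
    congr 1
    ext
    simp only
    omega

theorem height_drop_ofFn {n : ℕ} {f : Fin n → ℕ} (hf : Function.Injective f) (i j : ℕ) :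
    height ((List.ofFn f).drop j).toFinset i =
      (Finset.univ.filter fun k : Fin n => j ≤ k.1 ∧ f k ≤ i).card := by
  rw [toFinset_drop_ofFn, height, Finset.filter_image, Finset.card_image_of_injective _ hf,
    Finset.filter_filter]

section Perm

variable {n : ℕ}

/-- The word of values of a permutation, shifted to lie in `{1, …, n}`. -/
def oneLine (σ : Equiv.Perm (Fin n)) (j : Fin n) : ℕ := (σ j).1 + 1

theorem oneLine_injective (σ : Equiv.Perm (Fin n)) : Function.Injective (oneLine σ) :=
  fun i j h => σ.injective (Fin.ext (by simpa [oneLine] using h))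

theorem height_oneLine (σ : Equiv.Perm (Fin n)) (j : Fin n) :
    height ((List.ofFn (oneLine σ)).drop j).toFinset (oneLine σ j - 1) = lehmer σ j := by
  rw [height_drop_ofFn (oneLine_injective σ), lehmer]
  congr 1
  ext k
  simp only [Finset.mem_filter, Finset.mem_univ, true_and, oneLine, Nat.add_sub_cancel]
  constructor
  · rintro ⟨h1, h2⟩
    refine ⟨lt_of_le_of_ne h1 ?_, h2⟩
    rintro rfl
    omega
  · exact fun h => ⟨h.1.le, h.2⟩

theorem lehmer'_apply (σ : Equiv.Perm (Fin n)) (j : Fin n) :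
    lehmer' σ (σ j) = (Finset.univ.filter fun i => i < j ∧ σ j < σ i).card := by
  rw [lehmer', lehmer, ← Finset.card_map (s := Finset.univ.filter fun i => i < j ∧ σ j < σ i)
    σ.toEmbedding]
  congr 1
  ext k
  simp only [Finset.mem_filter, Finset.mem_univ, true_and, Finset.mem_map, Equiv.coe_toEmbedding,
    Equiv.Perm.inv_def, Equiv.symm_apply_apply]
  constructor
  · exact fun h => ⟨σ.symm k, ⟨h.2, by simpa using h.1⟩, by simp⟩
  · rintro ⟨i, h, rfl⟩
    exact ⟨h.2, by simpa using h.1⟩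

/-- Count the positions with smaller value (`σ j` of them) and the earlier positions (`j` of them);
remove what they share. What remains is `lehmer σ j` for the first set and `lehmer' σ (σ j)` for the
second. -/
theorem val_add_lehmer' (σ : Equiv.Perm (Fin n)) (j : Fin n) :
    (σ j).1 + lehmer' σ (σ j) = j.1 + lehmer σ j := by
  have h1 : (Finset.univ.filter fun i => σ i < σ j).card = (σ j).1 := by
    rw [← Finset.card_map σ.toEmbedding, ← Fin.card_Iio (σ j)]
    congr 1
    ext k
    simp only [Finset.mem_map, Finset.mem_filter, Finset.mem_univ, true_and,
      Equiv.coe_toEmbedding, Finset.mem_Iio]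
    exact ⟨fun ⟨i, h, hi⟩ => hi ▸ h, fun h => ⟨σ⁻¹ k, by simpa using h, by simp⟩⟩
  have h2 : (Finset.univ.filter fun i => i < j).card = j.1 := by
    rw [Finset.filter_gt_eq_Iio, Fin.card_Iio]
  have h3 := Finset.card_filter_add_card_filter_not
    (s := Finset.univ.filter fun i => σ i < σ j) (fun i => i < j)
  have h4 := Finset.card_filter_add_card_filter_not
    (s := Finset.univ.filter fun i => i < j) (fun i => σ i < σ j)
  rw [Finset.filter_filter, Finset.filter_filter] at h3 h4
  have e1 : (Finset.univ.filter fun i => σ i < σ j ∧ ¬ i < j).card = lehmer σ j := by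
    rw [lehmer]
    congr 1
    ext i
    simp only [Finset.mem_filter, Finset.mem_univ, true_and, not_lt]
    refine ⟨fun h => ⟨lt_of_le_of_ne h.2 ?_, h.1⟩, fun h => ⟨h.2, h.1.le⟩⟩
    rintro rfl
    exact lt_irrefl _ h.1
  have e2 : (Finset.univ.filter fun i => i < j ∧ ¬ σ i < σ j).card = lehmer' σ (σ j) := by
    rw [lehmer'_apply]
    congr 1
    ext i
    simp only [Finset.mem_filter, Finset.mem_univ, true_and, not_lt]
    refine ⟨fun h => ⟨h.1, lt_of_le_of_ne h.2 ?_⟩, fun h => ⟨h.1, h.2.le⟩⟩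
    intro h'
    exact h.1.ne (σ.injective h').symm
  have e3 : (Finset.univ.filter fun i => σ i < σ j ∧ i < j).card =
      (Finset.univ.filter fun i => i < j ∧ σ i < σ j).card := by
    simp only [and_comm]
  omega

/-- The word of a pair of permutations. -/
def pairWord (p : Equiv.Perm (Fin n) × Equiv.Perm (Fin n)) : List (ℕ × ℕ) :=
  List.ofFn fun j => (oneLine p.1 j, oneLine p.2 j)

theorem pairWord_injective : Function.Injective (pairWord (n := n)) := by
  intro p q h
  have h' := List.ofFn_injective h
  have h1 : ∀ j, p.1 j = q.1 j ∧ p.2 j = q.2 j := fun j => by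
    simpa [oneLine, Fin.ext_iff] using congrFun h' j
  exact Prod.ext (Equiv.ext fun j => (h1 j).1) (Equiv.ext fun j => (h1 j).2)

theorem toFinset_oneLine (σ : Equiv.Perm (Fin n)) :
    (List.ofFn (oneLine σ)).toFinset = Finset.Icc 1 n := by
  ext x
  simp only [List.mem_toFinset, List.mem_ofFn, Finset.mem_Icc, oneLine]
  constructor
  · rintro ⟨j, rfl⟩
    omega
  · intro hx
    exact ⟨σ⁻¹ ⟨x - 1, by omega⟩, by simp; omega⟩

theorem removes_pairWord_iff (p : Equiv.Perm (Fin n) × Equiv.Perm (Fin n)) :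
    Removes (Finset.Icc 1 n) (Finset.Icc 1 n) (pairWord p) ∅ ∅ ↔ p ∈ GP n := by
  have e1 : (pairWord p).map Prod.fst = List.ofFn (oneLine p.1) := by
    rw [pairWord, List.map_ofFn]; rfl
  have e2 : (pairWord p).map Prod.snd = List.ofFn (oneLine p.2) := by
    rw [pairWord, List.map_ofFn]; rfl
  have key : ∀ j : Fin n, IsGood ((List.ofFn (oneLine p.1)).drop j).toFinset
      ((List.ofFn (oneLine p.2)).drop j).toFinset (oneLine p.1 j) (oneLine p.2 j) ↔
      lehmer p.1 j ≥ lehmer p.2 j ∧ lehmer' p.1 (p.1 j) ≥ lehmer' p.2 (p.2 j) := fun j => by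
    have h1 := val_add_lehmer' p.1 j
    have h2 := val_add_lehmer' p.2 j
    have d1 : oneLine p.1 j = (p.1 j).1 + 1 := rfl
    have d2 : oneLine p.2 j = (p.2 j).1 + 1 := rfl
    constructor
    · rintro ⟨-, -, hn, hw⟩
      rw [height_oneLine, height_oneLine] at hn hw
      omega
    · rintro ⟨h3, h4⟩
      refine ⟨?_, ?_, ?_, ?_⟩
      · rw [toFinset_drop_ofFn]
        exact Finset.mem_image_of_mem _ (by simp)
      · rw [toFinset_drop_ofFn]
        exact Finset.mem_image_of_mem _ (by simp)
      · rwa [height_oneLine, height_oneLine]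
      · rw [height_oneLine, height_oneLine]
        omega
  rw [removes_iff, e1, e2, toFinset_oneLine, toFinset_oneLine]
  simp only [List.nodup_ofFn.2 (oneLine_injective _), true_and]
  constructor
  · intro h j
    have := h j (by simp [pairWord])
    exact (key j).1 (by simpa [pairWord] using this)
  · intro h j hj
    have hj' : j < n := by simpa [pairWord] using hj
    simpa [pairWord] using (key ⟨j, hj'⟩).2 (h ⟨j, hj'⟩)

theorem isChain_pairWord_iff (p : Equiv.Perm (Fin n) × Equiv.Perm (Fin n)) :
    (pairWord p).IsChain (fun a b => ¬ Ascends a b) ↔ ascents p.1 ∩ ascents p.2 = ∅ := by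
  rw [List.isChain_iff_getElem, Set.eq_empty_iff_forall_notMem]
  simp only [pairWord, List.length_ofFn, List.getElem_ofFn, Ascends, oneLine, ascents,
    add_lt_add_iff_right, Set.mem_inter_iff, Set.mem_ofPred_eq]
  constructor
  · rintro h i ⟨⟨hi, h1⟩, ⟨_, h2⟩⟩
    exact h i.1 hi ⟨h1, h2⟩
  · rintro h i hi ⟨h1, h2⟩
    exact h ⟨i, by omega⟩ ⟨⟨hi, h1⟩, ⟨hi, h2⟩⟩

theorem exists_perm_oneLine {a : List ℕ} (ha : a.Nodup) (hl : a.length = n)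
    (hn : ∀ x ∈ a, x ∈ Finset.Icc 1 n) : ∃ σ : Equiv.Perm (Fin n), a = List.ofFn (oneLine σ) := by
  subst hl
  have hmem : ∀ j : Fin a.length, 1 ≤ a[j] ∧ a[j] ≤ a.length := fun j =>
    Finset.mem_Icc.1 (hn _ (List.getElem_mem _))
  let f : Fin a.length → Fin a.length := fun j => ⟨a[j] - 1, by have := hmem j; omega⟩
  have hf : Function.Injective f := by
    intro i j hij
    have h1 := hmem i
    have h2 := hmem j
    have h3 : a[i] - 1 = a[j] - 1 := congrArg Fin.val hij
    have h4 : a[i] = a[j] := by omega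
    exact Fin.ext ((ha.getElem_inj_iff).1 h4)
  refine ⟨Equiv.ofBijective f (Finite.injective_iff_bijective.1 hf), ?_⟩
  refine List.ext_getElem (by simp) fun i h1 h2 => ?_
  have := hmem ⟨i, h1⟩
  simp only [List.getElem_ofFn, oneLine, Equiv.ofBijective_apply, f]
  simp only [Fin.getElem_fin] at this ⊢
  omega

theorem exists_pairWord_eq {w : List (ℕ × ℕ)}
    (hw : Removes (Finset.Icc 1 n) (Finset.Icc 1 n) w ∅ ∅) : ∃ p, pairWord (n := n) p = w := by
  have hl : w.length = n := by simpa using hw.card_eq.symm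
  obtain ⟨σ, hσ⟩ := exists_perm_oneLine hw.upper.2.1 (by simpa using hl)
    fun x hx => by simpa using (hw.upper.2.2 x).1 hx
  obtain ⟨τ, hτ⟩ := exists_perm_oneLine hw.lower.2.1 (by simpa using hl)
    fun x hx => by simpa using (hw.lower.2.2 x).1 hx
  refine ⟨(σ, τ), List.ext_getElem (by simp [pairWord, hl]) fun i h1 h2 => ?_⟩
  have hi : i < n := by omega
  have e1 : w[i].1 = (w.map Prod.fst)[i]'(by simpa using h2) := by simp
  have e2 : w[i].2 = (w.map Prod.snd)[i]'(by simpa using h2) := by simp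
  refine Prod.ext ?_ ?_
  · rw [e1]; simp [hσ, pairWord]
  · rw [e2]; simp [hτ, pairWord]

theorem card_ascentFree_uniformTop (n : ℕ) :
    (uniformTop n).ascentFree.card =
      Set.ncard {p : Equiv.Perm (Fin n) × Equiv.Perm (Fin n) |
        p ∈ GP n ∧ ascents p.1 ∩ ascents p.2 = ∅} := by
  rw [← Set.ncard_image_of_injective _ pairWord_injective, ← Set.ncard_coe_finset]
  congr 1
  ext w
  rw [Finset.mem_coe, LPM.mem_ascentFree, (LPM.uniformTop_paths n).1, (LPM.uniformTop_paths n).2]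
  constructor
  · rintro ⟨h1, h2⟩
    obtain ⟨p, rfl⟩ := exists_pairWord_eq h1
    exact ⟨p, ⟨(removes_pairWord_iff p).1 h1, (isChain_pairWord_iff p).1 h2⟩, rfl⟩
  · rintro ⟨p, ⟨h1, h2⟩, rfl⟩
    exact ⟨(removes_pairWord_iff p).2 h1, (isChain_pairWord_iff p).2 h2⟩

theorem uniformZero_le_uniformTop (n : ℕ) : uniformZero n ≤ uniformTop n := by
  refine LPM.zero_le_of_removes (w := pairWord (n := n) (1, 1)) ?_
  rw [(LPM.uniformTop_paths n).1, (LPM.uniformTop_paths n).2, removes_pairWord_iff]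
  exact fun j => ⟨le_rfl, le_rfl⟩

end Perm

end LatticePathMatroid

/-! ### The Möbius number of the full interval -/

theorem theorem3p6 (n : ℕ) :
    IncidenceAlgebra.mu ℤ (LatticePathMatroid.uniformZero n) (LatticePathMatroid.uniformTop n) =
      (-1) ^ n *
        (Set.ncard {p : Equiv.Perm (Fin n) × Equiv.Perm (Fin n) |
          p ∈ LatticePathMatroid.GP n ∧
            LatticePathMatroid.ascents p.1 ∩ LatticePathMatroid.ascents p.2 = ∅} : ℤ) := by
  rw [LatticePathMatroid.LPM.mu_uniformZero _ (LatticePathMatroid.uniformZero_le_uniformTop n),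
    LatticePathMatroid.card_ascentFree_uniformTop, (LatticePathMatroid.LPM.uniformTop_paths n).1]
  simp
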